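/- Let $n\ge 1$ and $\lambda_1,\dots,\lambda_n\in\mathbb{C}$. Let $$H^{D_n}=-\frac12\sum_{j=1}^n\frac{\partial^2}{\partial x_j^2}+\sum_{j=1}^{n-1}e^{x_{j+1}-x_j}+e^{-x_n-x_{n-1}}$$ be the quadratic Hamiltonian of the open Toda chain of type $D_n$ (for $n=1$ there is no potential: $H^{D_1}=-\frac12\partial_{x_1}^2$). For $k\ge1$, $x\in\mathbb{R}^{k+1}$, $x'\in\mathbb{R}^{k}$, $z\in\mathbb{C}^k$ put $$Q_{D_{k+1}}^{C_k}(x;z)=\exp\Big\{\sum_{i=1}^k\big(e^{z_i-x_i}+e^{x_{i+1}-z_i}\big)+e^{-x_{k+1}-z_k}\Big\},$$ $$Q_{C_k}^{D_k}(z;x')=\exp\Big\{\sum_{i=1}^{k-1}\big(e^{x'_i-z_i}+e^{z_{i+1}-x'_i}\big)+e^{x'_k-z_k}+e^{-x'_k-z_k}\Big\},$$ and, for $\lambda\in\mathbb{C}$, $$Q_{D_{k+1}}^{D_k}(x,x',\lambda)=\int_{(\mathbb{R}+i\pi)^k}\prod_{i=1}^k dz_i\; e^{i\lambda(\sum_{i=1}^{k+1}x_i+\sum_{i=1}^k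 x'_i-2\sum_{i=1}^k z_i)}\big(e^{-x_{k+1}}+e^{-x'_k}\big)^{2i\lambda}\,Q_{D_{k+1}}^{C_k}(x;z)\,Q_{C_k}^{D_k}(z;x').$$ For $x=(x_1,\dots,x_n)\in\mathbb{R}^n$ define, with $x_{n,i}:=x_i$ and $x_k=(x_{k,1},\dots,x_{k,k})$, $$\Psi^{D_n}_{\lambda_1,\dots,\lambda_n}(x)=\int_{\mathbb{R}^{n(n-1)/2}}\prod_{k=1}^{n-1}\prod_{i=1}^k dx_{k,i}\; e^{i\lambda_1x_{1,1}}\prod_{k=1}^{n-1}Q_{D_{k+1}}^{D_k}(x_{k+1},x_k,\lambda_{k+1}).$$ (1) The integrals defining the kernels $Q_{D_{k+1}}^{D_k}(x,x',\lambda_{k+1})$, $1\le k\le n-1$, and the integral defining $\Psi^{D_n}_{\lambda_1,\dots,\lambda_n}(x)$ converge absolutely for all real arguments; $\Psi^{D_n}_{\lambda_1,\dots,\lambda_n}$ is twice continuously differentiable on $\mathbb{R}^n$, and $$H^{D_n}\,\Psi^{D_n}_{\lambda_1,\dots,\lambda_n}=\frac12\Big(\sum_{i=1}^n\lambda_i^2\Big)\Psi^{D_n}_{\lambda_1,\dots,\lambda_n}.$$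 (2) Let $1\le k\le n-1$, $\lambda=\lambda_{k+1}$, and let $\theta\in\mathbb{R}$ satisfy $|\theta|<\pi/2$ and $\operatorname{Im}(\lambda e^{i\theta})>0$. Let $C_\theta$ be the contour that runs along $i\pi+(-\infty,0]$ and then along the ray $i\pi+e^{i\theta}[0,\infty)$ (so $C_0=\mathbb{R}+i\pi$, which is admissible if $\operatorname{Im}\lambda>0$; for real $\lambda\neq0$ the condition says that $\theta$ has the sign of $\lambda$ and is nonzero). Then for all $x\in\mathbb{R}^{k+1}$, $x'\in\mathbb{R}^k$ $$Q_{D_{k+1}}^{D_k}(x,x',\lambda)=\frac{e^{2\pi\lambda}}{\Gamma(-2i\lambda)}\int_{(\mathbb{R}+i\pi)^k\times C_\theta}\prod_{i=1}^k dz_i\,dy\; e^{i\lambda(\sum_{i=1}^{k+1} x_i+\sum_{i=1}^k x'_i-2\sum_{i=1}^k z_i+2y)}\,Q_{D_{k+1}}^{C_k}(x;z,y)\,Q_{C_k}^{D_k}(z;x',y),$$ with an absolutely convergent integral, where $Q_{D_{k+1}}^{C_k}(x;z,y)=Q_{D_{k+1}}^{C_k}(x;z)\exp(e^{-x_{k+1}-y})$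 and $Q_{C_k}^{D_k}(z;x',y)=Q_{C_k}^{D_k}(z;x')\exp(e^{-x'_k-y})$. -/

import Mathlib

open MeasureTheory

namespace TodaD

noncomputable section

/-- The boundary term of the potential of the open Toda chain of type `D_{m+1}`:
`e^{-x_n-x_{n-1}}` with `n = m + 1`; it is absent in rank one. -/
def boundaryPotential : (m : ℕ) → (Fin (m + 1) → ℝ) → ℝ
  | 0, _ => 0
  | m + 1, x => Real.exp (-x (Fin.last (m + 1)) - x (Fin.last m).castSucc)

/-- The quadratic Hamiltonian of the open Toda chain of type `D_n`, `n = m + 1`: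
`-(1/2) ∑ ∂²/∂x_j² + ∑_{j<n} e^{x_{j+1}-x_j} + e^{-x_n-x_{n-1}}`. -/
def hamiltonian (m : ℕ) (f : (Fin (m + 1) → ℝ) → ℂ) (x : Fin (m + 1) → ℝ) : ℂ :=
  -(1 / 2 : ℂ) * ∑ j, iteratedDeriv 2 (fun t : ℝ => f (Function.update x j t)) (x j)
    + (((∑ j : Fin m, Real.exp (x j.succ - x j.castSucc)) + boundaryPotential m x : ℝ) : ℂ) * f x

/-- The elementary kernel `Q_{D_{k+1}}^{C_k}(x; z)`, `k = r + 1`. -/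
def kernelDC (r : ℕ) (x : Fin (r + 2) → ℝ) (z : Fin (r + 1) → ℂ) : ℂ :=
  Complex.exp
    ((∑ i : Fin (r + 1), (Complex.exp (z i - x i.castSucc) + Complex.exp (x i.succ - z i)))
      + Complex.exp (-x (Fin.last (r + 1)) - z (Fin.last r)))

/-- The elementary kernel `Q_{C_k}^{D_k}(z; x')`, `k = r + 1`. -/
def kernelCD (r : ℕ) (z : Fin (r + 1) → ℂ) (x' : Fin (r + 1) → ℝ) : ℂ :=
  Complex.exp
    ((∑ i : Fin r, (Complex.exp (x' i.castSucc - z i.castSucc)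
        + Complex.exp (z i.succ - x' i.castSucc)))
      + Complex.exp (x' (Fin.last r) - z (Fin.last r))
      + Complex.exp (-x' (Fin.last r) - z (Fin.last r)))

/-- Parametrization of the integration contour `(ℝ + iπ)^k` of the variables `z`. -/
def zContour {k : ℕ} (t : Fin k → ℝ) (i : Fin k) : ℂ := t i + Real.pi * Complex.I

/-- The integrand, in the parameter `t` of the contour `z = t + iπ`, of the recursive kernel
`Q_{D_{k+1}}^{D_k}(x, x', lam)`, `k = r + 1`. -/
def recIntegrand (r : ℕ) (lam : ℂ) (x : Fin (r + 2) → ℝ) (x' : Fin (r + 1) → ℝ)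
    (t : Fin (r + 1) → ℝ) : ℂ :=
  Complex.exp (Complex.I * lam *
      ((∑ i, (x i : ℂ)) + (∑ i, (x' i : ℂ)) - 2 * ∑ i, zContour t i))
    * ((Real.exp (-x (Fin.last (r + 1))) + Real.exp (-x' (Fin.last r)) : ℝ) : ℂ)
        ^ (2 * Complex.I * lam)
    * kernelDC r x (zContour t) * kernelCD r (zContour t) x'

/-- The recursive kernel `Q_{D_{k+1}}^{D_k}(x, x', lam)`, `k = r + 1`. -/
def recKernel (r : ℕ) (lam : ℂ) (x : Fin (r + 2) → ℝ) (x' : Fin (r + 1) → ℝ) : ℂ :=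
  ∫ t : Fin (r + 1) → ℝ, recIntegrand r lam x x' t

/-- The triangular arrays `(x_{k,i})`, `1 ≤ k ≤ m`, `1 ≤ i ≤ k`; the row with index `k` here
has `k + 1` entries. -/
abbrev Triangle (m : ℕ) : Type := (k : Fin m) → Fin ((k : ℕ) + 1) → ℝ

/-- The triangle completed by the bottom row `x_{n,i} = x_i`, `n = m + 1`. -/
def complete {m : ℕ} (X : Triangle m) (x : Fin (m + 1) → ℝ) : Triangle (m + 1) :=
  Fin.snoc (α := fun k : Fin (m + 1) => Fin ((k : ℕ) + 1) → ℝ) X x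

/-- The integrand `e^{i lam_1 x_{11}} ∏_{k=1}^{n-1} Q_{D_{k+1}}^{D_k}(x_{k+1}, x_k, lam_{k+1})`
of the wave function, `n = m + 1`. -/
def waveIntegrand (m : ℕ) (lam : Fin (m + 1) → ℂ) (x : Fin (m + 1) → ℝ) (X : Triangle m) : ℂ :=
  Complex.exp (Complex.I * lam 0 * (complete X x 0 0 : ℝ))
    * ∏ k : Fin m, recKernel k (lam k.succ) (complete X x k.succ) (complete X x k.castSucc)

/-- The wave function `Ψ^{D_n}_{lam_1, …, lam_n}(x_1, …, x_n)`, `n = m + 1`. -/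
def wave (m : ℕ) (lam : Fin (m + 1) → ℂ) (x : Fin (m + 1) → ℝ) : ℂ :=
  ∫ X : Triangle m, waveIntegrand m lam x X

/-- `Q_{D_{k+1}}^{C_k}(x; z, y)`, `k = r + 1`. -/
def kernelDCy (r : ℕ) (x : Fin (r + 2) → ℝ) (z : Fin (r + 1) → ℂ) (y : ℂ) : ℂ :=
  Complex.exp
    ((∑ i : Fin (r + 1), (Complex.exp (z i - x i.castSucc) + Complex.exp (x i.succ - z i)))
      + Complex.exp (-x (Fin.last (r + 1)) - z (Fin.last r))
      + Complex.exp (-x (Fin.last (r + 1)) - y))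

/-- `Q_{C_k}^{D_k}(z; x', y)`, `k = r + 1`. -/
def kernelCDy (r : ℕ) (z : Fin (r + 1) → ℂ) (x' : Fin (r + 1) → ℝ) (y : ℂ) : ℂ :=
  Complex.exp
    ((∑ i : Fin r, (Complex.exp (x' i.castSucc - z i.castSucc)
        + Complex.exp (z i.succ - x' i.castSucc)))
      + Complex.exp (x' (Fin.last r) - z (Fin.last r))
      + Complex.exp (-x' (Fin.last r) - z (Fin.last r))
      + Complex.exp (-x' (Fin.last r) - y))

/-- The contour of the variable `y`: the half-line `iπ + (-∞, 0]` followed by the ray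
`iπ + e^{iθ} [0, ∞)`. For `θ = 0` it is the line `ℝ + iπ`. -/
def yContour (θ s : ℝ) : ℂ :=
  Real.pi * Complex.I + (if s ≤ 0 then (s : ℂ) else s * Complex.exp (θ * Complex.I))

/-- The velocity `dy/ds` along `yContour θ`. -/
def yVelocity (θ s : ℝ) : ℂ := if s ≤ 0 then 1 else Complex.exp (θ * Complex.I)

/-- The integrand of the second form of the recursive kernel in the parameters `(t, s)` of the
contours `z = t + iπ`, `y = yContour θ s`. -/
def altIntegrand (r : ℕ) (lam : ℂ) (θ : ℝ) (x : Fin (r + 2) → ℝ) (x' : Fin (r + 1) → ℝ)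
    (p : (Fin (r + 1) → ℝ) × ℝ) : ℂ :=
  Complex.exp (Complex.I * lam *
      ((∑ i, (x i : ℂ)) + (∑ i, (x' i : ℂ)) - 2 * (∑ i, zContour p.1 i) + 2 * yContour θ p.2))
    * kernelDCy r x (zContour p.1) (yContour θ p.2)
    * kernelCDy r (zContour p.1) x' (yContour θ p.2)
    * yVelocity θ p.2

end

end TodaD

namespace TodaD

noncomputable section

/-!
The integrand of the kernel `Q_{D_{r+2}}^{D_{r+1}}(x, x', λ)` intertwines `H^{D_{r+2}} - λ²/2` in
`x` with `H^{D_{r+1}}` in `x'`, up to a divergence in the integration variables `t = z - iπ`. On the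
contour `ℝ + iπ` all exponentials `e^{e^{…}}` become `e^{-e^{…}}`, so everything decays faster than
any exponential in `(x', t)` and divergences integrate to zero; induction on the rank then gives the
eigenvalue equation. To verify the intertwining, compare the second logarithmic derivatives of the
integrand: what remains after completing squares cancels because, with
`p = e^{-x_{r+2}} / (e^{-x_{r+2}} + e^{-x'_{r+1}})`, the exponentials involving the last coordinates
satisfy `p e^{-x'_{r+1} - t_{r+1}} = (1 - p) e^{-x_{r+2} - t_{r+1}}` and
`p e^{x_{r+2} - t_{r+1}} = (1 - p) e^{x'_{r+1} - t_{r+1}}`.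

The variable `y` of the second form enters only through a Gamma integral with parameter
`a = -2iλ`. On the ray `e^{iθ} [0, ∞)` the integrand expands into a series of exponentials whose
integral `∑ (-S)^n / (n! (a + n))` does not depend on `θ`, which reduces the case `Re a > 0` to
Euler's integral; integration by parts, `a ↦ a + 1`, reaches the remaining parameters.
-/

/-! ### Growth classes -/

section GrowthBounds

variable {W X F 𝔸 : Type*} [SeminormedAddCommGroup W] [SeminormedAddCommGroup X]
  [SeminormedAddCommGroup F] [NonUnitalSeminormedRing 𝔸]

/-- At most exponential growth. -/
def ExpBounded (f : W → F) : Prop := ∃ C A : ℝ, ∀ w, ‖f w‖ ≤ C * Real.exp (A * ‖w‖)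

/-- Decay faster than any exponential in the second variable, with at most exponential growth
in the first one. -/
def RapidlyDecaying (f : W × X → F) : Prop :=
  ∀ B : ℝ, ∃ C A : ℝ, ∀ x y, ‖f (x, y)‖ ≤ C * Real.exp (A * ‖x‖ - B * ‖y‖)

theorem ExpBounded.exists_nonneg {f : W → F} (h : ExpBounded f) :
    ∃ C A : ℝ, 0 ≤ C ∧ 0 ≤ A ∧ ∀ w, ‖f w‖ ≤ C * Real.exp (A * ‖w‖) := by
  obtain ⟨C, A, h⟩ := h
  refine ⟨|C|, |A|, abs_nonneg _, abs_nonneg _, fun w => (h w).trans ?_⟩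
  gcongr
  · exact le_abs_self C
  · exact le_abs_self A

theorem ExpBounded.const (c : F) : ExpBounded (fun _ : W => c) := ⟨‖c‖, 0, by simp⟩

theorem ExpBounded.add {f g : W → F} (hf : ExpBounded f) (hg : ExpBounded g) :
    ExpBounded (fun w => f w + g w) := by
  obtain ⟨C, A, hC, hA, hf⟩ := hf.exists_nonneg
  obtain ⟨D, B, hD, hB, hg⟩ := hg.exists_nonneg
  refine ⟨C + D, A + B, fun w => ?_⟩
  calc ‖f w + g w‖ ≤ C * Real.exp (A * ‖w‖) + D * Real.exp (B * ‖w‖) :=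
        (norm_add_le _ _).trans (add_le_add (hf w) (hg w))
    _ ≤ C * Real.exp ((A + B) * ‖w‖) + D * Real.exp ((A + B) * ‖w‖) := by gcongr <;> linarith
    _ = (C + D) * Real.exp ((A + B) * ‖w‖) := by ring

theorem ExpBounded.mul {f g : W → 𝔸} (hf : ExpBounded f) (hg : ExpBounded g) :
    ExpBounded (fun w => f w * g w) := by
  obtain ⟨C, A, hC, -, hf⟩ := hf.exists_nonneg
  obtain ⟨D, B, -, -, hg⟩ := hg.exists_nonneg
  refine ⟨C * D, A + B, fun w => (norm_mul_le _ _).trans ?_⟩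
  rw [add_mul, Real.exp_add, mul_mul_mul_comm]
  exact mul_le_mul (hf w) (hg w) (norm_nonneg _) (by positivity)

theorem ExpBounded.comp_clm [NormedSpace ℝ W] [NormedSpace ℝ X] {f : W → F}
    (hf : ExpBounded f) (L : X →L[ℝ] W) : ExpBounded (fun x => f (L x)) := by
  obtain ⟨C, A, hC, hA, hf⟩ := hf.exists_nonneg
  refine ⟨C, A * ‖L‖, fun x => (hf _).trans ?_⟩
  rw [mul_assoc]
  gcongr
  exact L.le_opNorm x

theorem RapidlyDecaying.exists_nonneg {f : W × X → F} (h : RapidlyDecaying f) (B : ℝ) :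
    ∃ C A : ℝ, 0 ≤ C ∧ 0 ≤ A ∧ ∀ x y, ‖f (x, y)‖ ≤ C * Real.exp (A * ‖x‖ - B * ‖y‖) := by
  obtain ⟨C, A, h⟩ := h B
  refine ⟨|C|, |A|, abs_nonneg _, abs_nonneg _, fun x y => (h x y).trans ?_⟩
  gcongr
  · exact le_abs_self C
  · exact le_abs_self A

theorem RapidlyDecaying.add {f g : W × X → F} (hf : RapidlyDecaying f)
    (hg : RapidlyDecaying g) : RapidlyDecaying (fun w => f w + g w) := by
  intro B
  obtain ⟨C, A, hC, hA, hf⟩ := hf.exists_nonneg B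
  obtain ⟨D, A', hD, hA', hg⟩ := hg.exists_nonneg B
  refine ⟨C + D, A + A', fun x y => ?_⟩
  calc ‖f (x, y) + g (x, y)‖
      ≤ C * Real.exp (A * ‖x‖ - B * ‖y‖) + D * Real.exp (A' * ‖x‖ - B * ‖y‖) :=
        (norm_add_le _ _).trans (add_le_add (hf x y) (hg x y))
    _ ≤ C * Real.exp ((A + A') * ‖x‖ - B * ‖y‖) + D * Real.exp ((A + A') * ‖x‖ - B * ‖y‖) := by
        gcongr <;> linarith
    _ = (C + D) * Real.exp ((A + A') * ‖x‖ - B * ‖y‖) := by ring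

theorem ExpBounded.mul_rapidlyDecaying {f g : W × X → 𝔸} (hf : ExpBounded f)
    (hg : RapidlyDecaying g) : RapidlyDecaying (fun w => f w * g w) := by
  intro B
  obtain ⟨C, A, hC, hA, hf⟩ := hf.exists_nonneg
  obtain ⟨D, A', hD, -, hg⟩ := hg.exists_nonneg (B + A)
  refine ⟨C * D, A + A', fun x y => ?_⟩
  have hnorm : ‖(x, y)‖ ≤ ‖x‖ + ‖y‖ := norm_prod_le_iff.2
    ⟨le_add_of_nonneg_right (norm_nonneg y), le_add_of_nonneg_left (norm_nonneg x)⟩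
  calc ‖f (x, y) * g (x, y)‖
      ≤ (C * Real.exp (A * ‖(x, y)‖)) * (D * Real.exp (A' * ‖x‖ - (B + A) * ‖y‖)) :=
        (norm_mul_le _ _).trans (mul_le_mul (hf _) (hg x y) (norm_nonneg _) (by positivity))
    _ = C * D * Real.exp (A * ‖(x, y)‖ + (A' * ‖x‖ - (B + A) * ‖y‖)) := by
        rw [Real.exp_add]; ring
    _ ≤ C * D * Real.exp ((A + A') * ‖x‖ - B * ‖y‖) := by
        gcongr
        linarith [mul_le_mul_of_nonneg_left hnorm hA]

theorem RapidlyDecaying.mono {F' : Type*} [SeminormedAddCommGroup F'] {f : W × X → F}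
    {g : W × X → F'} (hg : RapidlyDecaying g) (hfg : ∀ w, ‖f w‖ ≤ ‖g w‖) : RapidlyDecaying f :=
  fun B => (hg B).imp fun _ => .imp fun _ h x y => (hfg (x, y)).trans (h x y)

theorem RapidlyDecaying.norm_le_exp_neg_norm {G : W × X → F} (hG : RapidlyDecaying G) :
    ∃ C A : ℝ, 0 ≤ C ∧ 0 ≤ A ∧
      ∀ x y, ‖G (x, y)‖ ≤ C * Real.exp (A * ‖x‖) * Real.exp (-‖y‖) := by
  obtain ⟨C, A, hC, hA, hG⟩ := hG.exists_nonneg 1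
  refine ⟨C, A, hC, hA, fun x y => (hG x y).trans_eq ?_⟩
  rw [mul_assoc, ← Real.exp_add, one_mul, sub_eq_add_neg]

end GrowthBounds

section GrowthClasses

variable {W X F 𝔸 : Type*} [NormedAddCommGroup W] [NormedSpace ℝ W]
  [NormedAddCommGroup X] [NormedSpace ℝ X] [NormedAddCommGroup F] [NormedSpace ℝ F]
  [NormedRing 𝔸] [NormedAlgebra ℝ 𝔸]

/-- The derivative of `f` in the direction `v`, as a function of the point. -/
def dirDeriv (v : W) (f : W → F) (w : W) : F := fderiv ℝ f w v

/-- The functions whose iterated directional derivatives up to order `n` exist, are continuous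
and all have the property `𝓑` (a growth condition). -/
def ControlledBy (𝓑 : (W → F) → Prop) : ℕ → (W → F) → Prop
  | 0, f => Continuous f ∧ 𝓑 f
  | n + 1, f => Differentiable ℝ f ∧ 𝓑 f ∧ ∀ v, ControlledBy 𝓑 n (dirDeriv v f)

theorem dirDeriv_const (v : W) (c : F) : dirDeriv v (fun _ : W => c) = fun _ => 0 := by
  funext w
  simp [dirDeriv]

theorem dirDeriv_clm (v : W) (L : W →L[ℝ] F) : dirDeriv v (fun w => L w) = fun _ => L v := by
  funext w
  simp [dirDeriv]

theorem dirDeriv_add {f g : W → F} (hf : Differentiable ℝ f) (hg : Differentiable ℝ g) (v : W) :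
    dirDeriv v (fun w => f w + g w) = fun w => dirDeriv v f w + dirDeriv v g w := by
  funext w
  simp only [dirDeriv, fderiv_fun_add (hf w) (hg w), add_apply]

theorem dirDeriv_sub {f g : W → F} (hf : Differentiable ℝ f) (hg : Differentiable ℝ g) (v : W) :
    dirDeriv v (fun w => f w - g w) = fun w => dirDeriv v f w - dirDeriv v g w := by
  funext w
  simp only [dirDeriv, fderiv_fun_sub (hf w) (hg w), sub_apply]

theorem dirDeriv_mul {f g : W → 𝔸} (hf : Differentiable ℝ f) (hg : Differentiable ℝ g) (v : W) :
    dirDeriv v (fun w => f w * g w) = fun w => f w * dirDeriv v g w + dirDeriv v f w * g w := by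
  funext w
  simp [dirDeriv, fderiv_fun_mul' (hf w) (hg w)]

theorem dirDeriv_const_mul {f : W → 𝔸} (hf : Differentiable ℝ f) (c : 𝔸) (v : W) :
    dirDeriv v (fun w => c * f w) = fun w => c * dirDeriv v f w := by
  funext w
  simp [dirDeriv, fderiv_const_mul (hf w)]

theorem dirDeriv_comp_clm {f : W → F} (hf : Differentiable ℝ f) (L : X →L[ℝ] W) (v : X) :
    dirDeriv v (fun x => f (L x)) = fun x => dirDeriv (L v) f (L x) := by
  funext x
  simp [dirDeriv, fderiv_fun_comp x (hf (L x)) L.differentiableAt]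

namespace ControlledBy

variable {𝓑 : (W → F) → Prop} {𝓑₁ 𝓑₂ : (W → 𝔸) → Prop}

theorem bound {n : ℕ} {f : W → F} (h : ControlledBy 𝓑 n f) : 𝓑 f := by
  cases n with
  | zero => exact h.2
  | succ n => exact h.2.1

theorem continuous {n : ℕ} {f : W → F} (h : ControlledBy 𝓑 n f) : Continuous f := by
  cases n with
  | zero => exact h.1
  | succ n => exact h.1.continuous

theorem differentiable {n : ℕ} {f : W → F} (h : ControlledBy 𝓑 (n + 1) f) :
    Differentiable ℝ f := h.1

theorem dirDeriv {n : ℕ} {f : W → F} (h : ControlledBy 𝓑 (n + 1) f) (v : W) :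
    ControlledBy 𝓑 n (dirDeriv v f) := h.2.2 v

theorem of_succ {n : ℕ} {f : W → F} (h : ControlledBy 𝓑 (n + 1) f) : ControlledBy 𝓑 n f := by
  induction n generalizing f with
  | zero => exact ⟨h.continuous, h.bound⟩
  | succ n ih => exact ⟨h.differentiable, h.bound, fun v => ih (h.dirDeriv v)⟩

theorem contDiff [FiniteDimensional ℝ W] {n : ℕ} {f : W → F} (h : ControlledBy 𝓑 n f) :
    ContDiff ℝ n f := by
  induction n generalizing f with
  | zero => exact contDiff_zero.2 h.continuous
  | succ n ih =>
    rw [Nat.cast_succ, contDiff_succ_iff_fderiv_apply]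
    exact ⟨h.differentiable, by simp, fun v => ih (h.dirDeriv v)⟩

theorem add (hadd : ∀ {f g}, 𝓑 f → 𝓑 g → 𝓑 (fun w => f w + g w)) {n : ℕ} {f g : W → F}
    (hf : ControlledBy 𝓑 n f) (hg : ControlledBy 𝓑 n g) :
    ControlledBy 𝓑 n (fun w => f w + g w) := by
  induction n generalizing f g with
  | zero => exact ⟨hf.continuous.add hg.continuous, hadd hf.bound hg.bound⟩
  | succ n ih =>
    refine ⟨hf.differentiable.add hg.differentiable, hadd hf.bound hg.bound, fun v => ?_⟩
    rw [dirDeriv_add hf.differentiable hg.differentiable]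
    exact ih (hf.dirDeriv v) (hg.dirDeriv v)

theorem mul (hadd : ∀ {f g}, 𝓑₂ f → 𝓑₂ g → 𝓑₂ (fun w => f w + g w))
    (hmul : ∀ {f g}, 𝓑₁ f → 𝓑₂ g → 𝓑₂ (fun w => f w * g w)) {n : ℕ} {f g : W → 𝔸}
    (hf : ControlledBy 𝓑₁ n f) (hg : ControlledBy 𝓑₂ n g) :
    ControlledBy 𝓑₂ n (fun w => f w * g w) := by
  induction n generalizing f g with
  | zero => exact ⟨hf.continuous.mul hg.continuous, hmul hf.bound hg.bound⟩
  | succ n ih =>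
    refine ⟨hf.differentiable.mul hg.differentiable, hmul hf.bound hg.bound, fun v => ?_⟩
    rw [dirDeriv_mul hf.differentiable hg.differentiable]
    exact (ih hf.of_succ (hg.dirDeriv v)).add hadd (ih (hf.dirDeriv v) hg.of_succ)

theorem of_dirDeriv_eq_mul (hadd : ∀ {f g}, 𝓑₂ f → 𝓑₂ g → 𝓑₂ (fun w => f w + g w))
    (hmul : ∀ {f g}, 𝓑₁ f → 𝓑₂ g → 𝓑₂ (fun w => f w * g w)) {f : W → 𝔸} {D : W → W → 𝔸}
    (hf : Differentiable ℝ f) (hbound : 𝓑₂ f) (hD : ∀ n v, ControlledBy 𝓑₁ n (D v))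
    (hderiv : ∀ v, TodaD.dirDeriv v f = fun w => D v w * f w) (n : ℕ) :
    ControlledBy 𝓑₂ n f := by
  induction n with
  | zero => exact ⟨hf.continuous, hbound⟩
  | succ n ih =>
    refine ⟨hf, hbound, fun v => ?_⟩
    rw [hderiv]
    exact (hD n v).mul hadd hmul ih

end ControlledBy

/-- Functions of at most exponential growth together with their directional derivatives up to
order `n`. -/
abbrev Tame (n : ℕ) (f : W → F) : Prop := ControlledBy ExpBounded n f

/-- Functions of rapid decay together with their directional derivatives up to order `n`. -/
abbrev Rapid (n : ℕ) (f : W × X → F) : Prop := ControlledBy RapidlyDecaying n f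

namespace Tame

theorem const (n : ℕ) (c : F) : Tame n (fun _ : W => c) := by
  induction n generalizing c with
  | zero => exact ⟨continuous_const, .const c⟩
  | succ n ih =>
    refine ⟨differentiable_const c, .const c, fun v => ?_⟩
    rw [dirDeriv_const]
    exact ih 0

theorem add {n : ℕ} {f g : W → F} (hf : Tame n f) (hg : Tame n g) :
    Tame n (fun w => f w + g w) := ControlledBy.add ExpBounded.add hf hg

theorem mul {n : ℕ} {f g : W → 𝔸} (hf : Tame n f) (hg : Tame n g) :
    Tame n (fun w => f w * g w) := ControlledBy.mul ExpBounded.add ExpBounded.mul hf hg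

theorem mul_rapid {n : ℕ} {f g : W × X → 𝔸} (hf : Tame n f) (hg : Rapid n g) :
    Rapid n (fun w => f w * g w) :=
  ControlledBy.mul RapidlyDecaying.add ExpBounded.mul_rapidlyDecaying hf hg

theorem const_mul {n : ℕ} {f : W → 𝔸} (c : 𝔸) (hf : Tame n f) : Tame n (fun w => c * f w) :=
  (const n c).mul hf

theorem sub {n : ℕ} {f g : W → 𝔸} (hf : Tame n f) (hg : Tame n g) :
    Tame n (fun w => f w - g w) := by
  simpa only [neg_mul, one_mul, ← sub_eq_add_neg] using hf.add (hg.const_mul (-1))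

theorem sum {ι : Type*} {n : ℕ} (s : Finset ι) {f : ι → W → F} (hf : ∀ i ∈ s, Tame n (f i)) :
    Tame n (fun w => ∑ i ∈ s, f i w) := by
  induction s using Finset.cons_induction with
  | empty => simpa using const n (0 : F)
  | cons i s hi ih =>
    simp only [Finset.sum_cons]
    exact (hf i (Finset.mem_cons_self i s)).add
      (ih fun j hj => hf j (Finset.mem_cons_of_mem hj))

theorem comp_clm {n : ℕ} {f : W → F} (hf : Tame n f) (L : X →L[ℝ] W) :
    Tame n (fun x => f (L x)) := by
  induction n generalizing f with
  | zero => exact ⟨hf.continuous.comp L.continuous, hf.bound.comp_clm L⟩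
  | succ n ih =>
    refine ⟨hf.differentiable.comp L.differentiable, hf.bound.comp_clm L, fun v => ?_⟩
    rw [dirDeriv_comp_clm hf.differentiable]
    exact ih (hf.dirDeriv (L v))

end Tame

theorem dirDeriv_cexp_const_mul_clm (c : ℂ) (L : W →L[ℝ] ℝ) (v : W) :
    dirDeriv v (fun w => Complex.exp (c * L w)) =
      fun w => c * L v * Complex.exp (c * L w) := by
  funext w
  have hderiv : HasFDerivAt (fun w => Complex.exp (c * L w)) _ w :=
    (((Complex.ofRealCLM.comp L).hasFDerivAt (x := w)).const_mul c).cexp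
  simp [dirDeriv, hderiv.fderiv, mul_comm]

theorem differentiable_cexp_const_mul_clm (c : ℂ) (L : W →L[ℝ] ℝ) :
    Differentiable ℝ (fun w => Complex.exp (c * L w)) :=
  ((Complex.ofRealCLM.comp L).differentiable.const_mul c).cexp

theorem Tame.cexp_const_mul_clm (n : ℕ) (c : ℂ) (L : W →L[ℝ] ℝ) :
    Tame n (fun w => Complex.exp (c * L w)) := by
  refine ControlledBy.of_dirDeriv_eq_mul ExpBounded.add ExpBounded.mul
    (differentiable_cexp_const_mul_clm c L) ⟨1, ‖c‖ * ‖L‖, fun w => ?_⟩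
    (fun n v => Tame.const n (c * L v)) (dirDeriv_cexp_const_mul_clm c L) n
  rw [Complex.norm_exp, one_mul, mul_assoc]
  gcongr
  refine (Complex.re_le_norm _).trans ?_
  rw [norm_mul, Complex.norm_real]
  gcongr
  exact L.le_opNorm w

namespace Rapid

variable [FiniteDimensional ℝ W] [FiniteDimensional ℝ X]

theorem rapidlyDecaying_fderiv {G : W × X → F} {n : ℕ} (hG : Rapid (n + 1) G) :
    RapidlyDecaying (fderiv ℝ G) := by
  intro B
  let basis := Module.finBasis ℝ (W × X)
  obtain ⟨K, -, hbasis⟩ := basis.exists_opNorm_le (F := F)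
  choose C A hC hA hG using fun i => (hG.dirDeriv (basis i)).bound.exists_nonneg B
  refine ⟨K * ∑ i, C i, ∑ i, A i, fun x y => ?_⟩
  have hCsum : 0 ≤ ∑ i, C i := Finset.sum_nonneg fun i _ => hC i
  rw [mul_assoc]
  refine hbasis (by positivity) fun i => (hG i x y).trans ?_
  gcongr
  · exact Finset.single_le_sum (fun i _ => hC i) (Finset.mem_univ i)
  · exact Finset.single_le_sum (fun i _ => hA i) (Finset.mem_univ i)

theorem rapidlyDecaying_fderiv_comp_inl {G : W × X → F} {n : ℕ} (hG : Rapid (n + 1) G) :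
    RapidlyDecaying (fun w => (fderiv ℝ G w).comp (.inl ℝ W X)) :=
  hG.rapidlyDecaying_fderiv.mono fun _ => (ContinuousLinearMap.opNorm_comp_le _ _).trans
    (mul_le_of_le_one_right (norm_nonneg _) (ContinuousLinearMap.norm_inl_le_one ℝ W X))

end Rapid

end GrowthClasses

/-! ### Integrals of rapidly decaying functions over the second variable -/

section ParametricIntegral

variable {E Y F : Type*} [NormedAddCommGroup E] [NormedAddCommGroup Y] [NormedSpace ℝ Y]
  [MeasurableSpace Y] [BorelSpace Y] [NormedAddCommGroup F]
  {μ : Measure Y} [μ.IsAddHaarMeasure]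

theorem integrable_exp_neg_norm [FiniteDimensional ℝ Y] :
    Integrable (fun y : Y => Real.exp (-‖y‖)) μ := by
  set d := Module.finrank ℝ Y + 1 with hd
  have hint : Integrable (fun y : Y => d.factorial * Real.exp 1 * (1 + ‖y‖) ^ (-(d : ℝ))) μ :=
    (integrable_one_add_norm (by simp [hd])).const_mul _
  refine hint.mono' (by fun_prop) (.of_forall fun y => ?_)
  have hpow := Real.pow_div_factorial_le_exp (1 + ‖y‖) (by positivity) d
  rw [div_le_iff₀' (by positivity), Real.exp_add] at hpow
  rw [Real.norm_of_nonneg (Real.exp_pos _).le, Real.rpow_neg (by positivity), Real.rpow_natCast,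
    Real.exp_neg, ← div_eq_mul_inv, le_div_iff₀ (by positivity), inv_mul_le_iff₀ (by positivity)]
  linarith

variable [FiniteDimensional ℝ Y]

theorem RapidlyDecaying.integrable {G : E × Y → F} (hG : RapidlyDecaying G) {x : E}
    (hmeas : AEStronglyMeasurable (fun y => G (x, y)) μ) : Integrable (fun y => G (x, y)) μ := by
  obtain ⟨C, A, -, -, hG⟩ := hG.norm_le_exp_neg_norm
  exact (integrable_exp_neg_norm.const_mul (C * Real.exp (A * ‖x‖))).mono' hmeas
    (.of_forall (hG x))

theorem RapidlyDecaying.exists_integrable_bound_ball {G : E × Y → F} (hG : RapidlyDecaying G)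
    (x₀ : E) : ∃ bound : Y → ℝ, Integrable bound μ ∧
      ∀ x ∈ Metric.ball x₀ 1, ∀ y, ‖G (x, y)‖ ≤ bound y := by
  obtain ⟨C, A, hC, hA, hG⟩ := hG.norm_le_exp_neg_norm
  refine ⟨fun y => C * Real.exp (A * (‖x₀‖ + 1)) * Real.exp (-‖y‖),
    integrable_exp_neg_norm.const_mul _, fun x hx y => (hG x y).trans ?_⟩
  have hnorm : ‖x‖ ≤ ‖x₀‖ + 1 := by
    linarith [norm_sub_norm_le x x₀, mem_ball_iff_norm.1 hx]
  beta_reduce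
  gcongr

theorem RapidlyDecaying.expBounded_integral_norm {G : E × Y → F} (hG : RapidlyDecaying G) :
    ExpBounded (fun x => ∫ y, ‖G (x, y)‖ ∂μ) := by
  obtain ⟨C, A, -, -, hG⟩ := hG.norm_le_exp_neg_norm
  refine ⟨C * ∫ y, Real.exp (-‖y‖) ∂μ, A, fun x => ?_⟩
  rw [Real.norm_of_nonneg (integral_nonneg fun y => norm_nonneg _)]
  calc ∫ y, ‖G (x, y)‖ ∂μ
      ≤ ∫ y, C * Real.exp (A * ‖x‖) * Real.exp (-‖y‖) ∂μ :=
        integral_mono_of_nonneg (.of_forall fun y => norm_nonneg _)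
          (integrable_exp_neg_norm.const_mul _) (.of_forall (hG x))
    _ = C * (∫ y, Real.exp (-‖y‖) ∂μ) * Real.exp (A * ‖x‖) := by
        rw [integral_const_mul]; ring

variable [NormedSpace ℝ F]

theorem RapidlyDecaying.expBounded_integral {G : E × Y → F} (hG : RapidlyDecaying G) :
    ExpBounded (fun x => ∫ y, G (x, y) ∂μ) := by
  obtain ⟨C, A, h⟩ := hG.expBounded_integral_norm (μ := μ)
  exact ⟨C, A, fun x => (norm_integral_le_integral_norm _).trans ((le_abs_self _).trans (h x))⟩

variable [NormedSpace ℝ E]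

namespace Rapid

theorem integrable {G : E × Y → F} {n : ℕ} (hG : Rapid n G) (x : E) :
    Integrable (fun y => G (x, y)) μ :=
  hG.bound.integrable (hG.continuous.comp (.prodMk_right x)).aestronglyMeasurable

theorem integral_dirDeriv_snd {G : E × Y → F} {n : ℕ} (hG : Rapid (n + 1) G) (x : E) (v : Y) :
    ∫ y, dirDeriv (0, v) G (x, y) ∂μ = 0 := by
  have hdiff : ∀ y, HasFDerivAt (fun y => G (x, y))
      ((fderiv ℝ G (x, y)).comp (.inr ℝ E Y)) y := fun y =>
    (hG.differentiable (x, y)).hasFDerivAt.comp y (hasFDerivAt_prodMk_right x y)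
  have hderiv : ∀ y, fderiv ℝ (fun y => G (x, y)) y v = dirDeriv (0, v) G (x, y) := fun y => by
    simp [(hdiff y).fderiv, dirDeriv]
  have hparts := integral_smul_fderiv_eq_neg_fderiv_smul_of_integrable (𝕜 := ℝ) (μ := μ) (v := v)
    (f := fun _ : Y => (1 : ℝ)) (g := fun y => G (x, y)) (by simp)
    (by simpa only [one_smul, hderiv] using Rapid.integrable (hG.dirDeriv (0, v)) x)
    (by simpa only [one_smul] using hG.integrable x)
    (fun _ _ => differentiableAt_const _) (fun y _ => (hdiff y).differentiableAt)
  simpa [hderiv] using hparts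

theorem integrable_sum_dirDeriv {ι : Type*} [Fintype ι] {G : ι → E × Y → F} {n : ℕ}
    (hG : ∀ i, Rapid (n + 1) (G i)) (x : E) (v : ι → E × Y) :
    Integrable (fun y => ∑ i, dirDeriv (v i) (G i) (x, y)) μ :=
  integrable_finsetSum _ fun i _ => Rapid.integrable ((hG i).dirDeriv (v i)) x

theorem integral_sum_dirDeriv_snd {ι : Type*} [Fintype ι] {G : ι → E × Y → F} {n : ℕ}
    (hG : ∀ i, Rapid (n + 1) (G i)) (x : E) (v : ι → Y) :
    ∫ y, ∑ i, dirDeriv (0, v i) (G i) (x, y) ∂μ = 0 := by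
  rw [integral_finsetSum _ fun i _ => Rapid.integrable ((hG i).dirDeriv (0, v i)) x]
  exact Finset.sum_eq_zero fun i _ => (hG i).integral_dirDeriv_snd x (v i)

theorem continuous_integral {G : E × Y → F} {n : ℕ} (hG : Rapid n G) :
    Continuous (fun x => ∫ y, G (x, y) ∂μ) := by
  refine continuous_iff_continuousAt.2 fun x₀ => ?_
  have hcont := hG.continuous
  obtain ⟨bound, hint, hbound⟩ := hG.bound.exists_integrable_bound_ball (μ := μ) x₀
  refine continuousAt_of_dominated (.of_forall fun x => (hG.integrable x).aestronglyMeasurable)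
    ?_ hint (.of_forall fun y => by fun_prop)
  filter_upwards [Metric.ball_mem_nhds x₀ one_pos] with x hx using .of_forall (hbound x hx)

variable [FiniteDimensional ℝ E]

theorem integrable_fderiv_comp_inl {G : E × Y → F} {n : ℕ} (hG : Rapid (n + 1) G) (x : E) :
    Integrable (fun y => (fderiv ℝ G (x, y)).comp (.inl ℝ E Y)) μ := by
  have hcont : Continuous (fderiv ℝ G) := hG.contDiff.continuous_fderiv (by simp)
  exact hG.rapidlyDecaying_fderiv_comp_inl.integrable
    ((hcont.comp (.prodMk_right x)).clm_comp continuous_const).aestronglyMeasurable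

theorem hasFDerivAt_integral {G : E × Y → F} {n : ℕ} (hG : Rapid (n + 1) G) (x₀ : E) :
    HasFDerivAt (fun x => ∫ y, G (x, y) ∂μ)
      (∫ y, (fderiv ℝ G (x₀, y)).comp (.inl ℝ E Y) ∂μ) x₀ := by
  obtain ⟨bound, hint, hbound⟩ :=
    hG.rapidlyDecaying_fderiv_comp_inl.exists_integrable_bound_ball (μ := μ) x₀
  refine hasFDerivAt_integral_of_dominated_of_fderiv_le
    (F' := fun x y => (fderiv ℝ G (x, y)).comp (.inl ℝ E Y))
    (Metric.ball_mem_nhds x₀ one_pos)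
    (.of_forall fun x => (hG.integrable x).aestronglyMeasurable) (hG.integrable x₀)
    (hG.integrable_fderiv_comp_inl x₀).aestronglyMeasurable
    (.of_forall fun y x hx => hbound x hx y) hint (.of_forall fun y x _ => ?_)
  exact (hG.differentiable (x, y)).hasFDerivAt.comp x (hasFDerivAt_prodMk_left x y)

theorem dirDeriv_integral [CompleteSpace F] {G : E × Y → F} {n : ℕ} (hG : Rapid (n + 1) G)
    (v : E) :
    dirDeriv v (fun x => ∫ y, G (x, y) ∂μ) = fun x => ∫ y, dirDeriv (v, 0) G (x, y) ∂μ := by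
  funext x
  rw [dirDeriv, (hG.hasFDerivAt_integral x).fderiv,
    ContinuousLinearMap.integral_apply (hG.integrable_fderiv_comp_inl x)]
  simp [dirDeriv]

theorem tame_integral [CompleteSpace F] {G : E × Y → F} {n : ℕ} (hG : Rapid n G) :
    Tame n (fun x => ∫ y, G (x, y) ∂μ) := by
  induction n generalizing G with
  | zero => exact ⟨hG.continuous_integral, hG.bound.expBounded_integral⟩
  | succ n ih =>
    refine ⟨fun x => (hG.hasFDerivAt_integral x).differentiableAt,
      hG.bound.expBounded_integral, fun v => ?_⟩
    rw [hG.dirDeriv_integral]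
    exact ih (hG.dirDeriv (v, 0))

end Rapid

end ParametricIntegral

/-! ### Exponentials of linear forms and of their exponentials -/

section ExponentialKernel

variable {W : Type*} [NormedAddCommGroup W] [NormedSpace ℝ W] {ι : Type*}

theorem dirDeriv_ofReal {f : W → ℝ} (hf : Differentiable ℝ f) (v : W) :
    dirDeriv v (fun w => (f w : ℂ)) = fun w => ((dirDeriv v f w : ℝ) : ℂ) := by
  funext w
  have hderiv : HasFDerivAt (fun w => (f w : ℂ)) _ w :=
    Complex.ofRealCLM.hasFDerivAt.comp w (hf w).hasFDerivAt
  simp [dirDeriv, hderiv.fderiv]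

theorem dirDeriv_cexp {f : W → ℂ} (hf : Differentiable ℝ f) (v : W) :
    dirDeriv v (fun w => Complex.exp (f w)) = fun w => dirDeriv v f w * Complex.exp (f w) := by
  funext w
  simp [dirDeriv, (hf w).hasFDerivAt.cexp.fderiv, mul_comm]

theorem differentiable_sigmoid_clm (L : W →L[ℝ] ℝ) :
    Differentiable ℝ (fun w => (Real.sigmoid (L w) : ℂ)) :=
  Complex.ofRealCLM.differentiable.comp L.differentiable.sigmoid

theorem dirDeriv_sigmoid_clm (L : W →L[ℝ] ℝ) (v : W) :
    dirDeriv v (fun w => (Real.sigmoid (L w) : ℂ)) =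
      fun w => L v * (Real.sigmoid (L w) * (1 - Real.sigmoid (L w)) : ℂ) := by
  rw [dirDeriv_ofReal (f := fun w => Real.sigmoid (L w)) L.differentiable.sigmoid]
  funext w
  have hderiv : HasFDerivAt (fun w => Real.sigmoid (L w)) _ w :=
    (Real.hasDerivAt_sigmoid (L w)).comp_hasFDerivAt w L.hasFDerivAt
  simp [dirDeriv, hderiv.fderiv, mul_comm]

theorem Tame.sigmoid_clm (n : ℕ) (L : W →L[ℝ] ℝ) :
    Tame n (fun w => (Real.sigmoid (L w) : ℂ)) := by
  have hdiff := differentiable_sigmoid_clm L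
  have hbound : ExpBounded (fun w => (Real.sigmoid (L w) : ℂ)) := ⟨1, 0, fun w => by
    rw [Complex.norm_of_nonneg (Real.sigmoid_nonneg _)]
    simpa using Real.sigmoid_le_one (L w)⟩
  induction n with
  | zero => exact ⟨hdiff.continuous, hbound⟩
  | succ n ih =>
    refine ⟨hdiff, hbound, fun v => ?_⟩
    rw [dirDeriv_sigmoid_clm]
    exact (ih.mul ((Tame.const n 1).sub ih)).const_mul _

/-- The softened maximum `log (e^α + e^β)` of two linear forms. -/
def logAddExp (α β : W →L[ℝ] ℝ) (w : W) : ℝ := Real.log (Real.exp (α w) + Real.exp (β w))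

theorem hasFDerivAt_logAddExp (α β : W →L[ℝ] ℝ) (w : W) :
    HasFDerivAt (logAddExp α β)
      (Real.sigmoid ((α - β) w) • α + (1 - Real.sigmoid ((α - β) w)) • β) w := by
  have hpos : Real.exp (α w) + Real.exp (β w) ≠ 0 := by positivity
  refine ((α.hasFDerivAt.exp.add β.hasFDerivAt.exp).log hpos).congr_fderiv ?_
  have hweight : Real.sigmoid ((α - β) w) = Real.exp (α w) / (Real.exp (α w) + Real.exp (β w)) := by
    rw [Real.sigmoid_def, sub_apply, neg_sub, Real.exp_sub]
    field_simp
  ext v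
  simp only [hweight, smul_apply, add_apply, smul_eq_mul, Pi.add_apply]
  field_simp
  ring

theorem differentiable_logAddExp (α β : W →L[ℝ] ℝ) : Differentiable ℝ (logAddExp α β) :=
  fun w => (hasFDerivAt_logAddExp α β w).differentiableAt

theorem dirDeriv_logAddExp (α β : W →L[ℝ] ℝ) (v : W) :
    dirDeriv v (logAddExp α β) =
      fun w => β v + (α v - β v) * Real.sigmoid ((α - β) w) := by
  funext w
  rw [dirDeriv, (hasFDerivAt_logAddExp α β w).fderiv]
  simp only [add_apply, smul_apply, smul_eq_mul]
  ring

theorem abs_logAddExp_le (α β : W →L[ℝ] ℝ) (w : W) :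
    |logAddExp α β w| ≤ Real.log 2 + (‖α‖ + ‖β‖) * ‖w‖ := by
  have hα : |α w| ≤ (‖α‖ + ‖β‖) * ‖w‖ := (α.le_opNorm w).trans (by gcongr; simp)
  have hβ : |β w| ≤ (‖α‖ + ‖β‖) * ‖w‖ := (β.le_opNorm w).trans (by gcongr; simp)
  rw [abs_le] at hα hβ ⊢
  constructor
  · have hle : α w ≤ logAddExp α β w :=
      (Real.le_log_iff_exp_le (by positivity)).2 (le_add_of_nonneg_right (Real.exp_pos _).le)
    linarith [Real.log_nonneg one_le_two]
  · rw [logAddExp, Real.log_le_iff_le_exp (by positivity), Real.exp_add, Real.exp_log two_pos]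
    linarith [Real.exp_le_exp.2 hα.2, Real.exp_le_exp.2 hβ.2]

theorem ExpBounded.cexp_const_mul_logAddExp (ν : ℂ) (α β : W →L[ℝ] ℝ) :
    ExpBounded (fun w => Complex.exp (ν * logAddExp α β w)) := by
  refine ⟨Real.exp (‖ν‖ * Real.log 2), ‖ν‖ * (‖α‖ + ‖β‖), fun w => ?_⟩
  rw [Complex.norm_exp, ← Real.exp_add, mul_assoc, ← mul_add, Real.exp_le_exp]
  calc (ν * logAddExp α β w).re ≤ ‖ν‖ * |logAddExp α β w| :=
        (Complex.re_le_norm _).trans_eq (by rw [norm_mul, Complex.norm_real, Real.norm_eq_abs])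
    _ ≤ ‖ν‖ * (Real.log 2 + (‖α‖ + ‖β‖) * ‖w‖) := by
        gcongr
        exact abs_logAddExp_le α β w

variable [Fintype ι]

/-- The linear combination `∑ c_i e^{L_i}` of exponentials of linear forms. -/
def expSum (c : ι → ℂ) (L : ι → W →L[ℝ] ℝ) (w : W) : ℂ := ∑ i, c i * Complex.exp (L i w)

theorem Tame.expSum (n : ℕ) (c : ι → ℂ) (L : ι → W →L[ℝ] ℝ) : Tame n (expSum c L) :=
  Tame.sum _ fun i _ => by
    simpa only [one_mul] using (Tame.cexp_const_mul_clm n 1 (L i)).const_mul (c i)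

theorem dirDeriv_expSum (c : ι → ℂ) (L : ι → W →L[ℝ] ℝ) (v : W) :
    dirDeriv v (expSum c L) = expSum (fun i => c i * L i v) L := by
  funext w
  have hderiv : ∀ i, HasFDerivAt (fun w => c i * Complex.exp (L i w)) _ w := fun i =>
    ((Complex.ofRealCLM.comp (L i)).hasFDerivAt (x := w)).cexp.const_mul (c i)
  have hsum : HasFDerivAt (expSum c L) _ w := .fun_sum (u := Finset.univ) fun i _ => hderiv i
  simp [dirDeriv, hsum.fderiv, expSum, mul_assoc, mul_comm (L _ v : ℂ)]

variable (c μ ν : ℂ) (ℓ α β : W →L[ℝ] ℝ) (L : ι → W →L[ℝ] ℝ)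

/-- The exponent of `expKernel`. -/
def logKernel (w : W) : ℂ := μ * ℓ w + ν * logAddExp α β w - expSum (fun _ => 1) L w

/-- The function `c e^{μ ℓ} (e^α + e^β)^ν ∏ e^{-e^{L_i}}`. -/
def expKernel (w : W) : ℂ := c * Complex.exp (logKernel μ ν ℓ α β L w)

theorem differentiable_logKernel : Differentiable ℝ (logKernel μ ν ℓ α β L) :=
  (((Complex.ofRealCLM.comp ℓ).differentiable.const_mul μ).add
    ((Complex.ofRealCLM.differentiable.comp (differentiable_logAddExp α β)).const_mul ν)).sub
    (Tame.expSum 1 _ L).differentiable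

theorem dirDeriv_logKernel (v : W) :
    dirDeriv v (logKernel μ ν ℓ α β L) = fun w =>
      μ * ℓ v + ν * (β v + (α v - β v) * Real.sigmoid ((α - β) w))
        - expSum (fun i => (L i v : ℂ)) L w := by
  have hℓ : Differentiable ℝ fun w => (ℓ w : ℂ) := (Complex.ofRealCLM.comp ℓ).differentiable
  have hΛ : Differentiable ℝ fun w => (logAddExp α β w : ℂ) :=
    Complex.ofRealCLM.differentiable.comp (differentiable_logAddExp α β)
  have hlin : Differentiable ℝ fun w => μ * (ℓ w : ℂ) + ν * logAddExp α β w :=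
    (hℓ.const_mul μ).add (hΛ.const_mul ν)
  change dirDeriv v (fun w => μ * (ℓ w : ℂ) + ν * logAddExp α β w - expSum _ L w) = _
  rw [dirDeriv_sub hlin (Tame.expSum 1 _ L).differentiable,
    dirDeriv_add (hℓ.const_mul μ) (hΛ.const_mul ν), dirDeriv_const_mul hΛ,
    dirDeriv_ofReal (differentiable_logAddExp α β), dirDeriv_logAddExp, dirDeriv_expSum,
    dirDeriv_const_mul hℓ, dirDeriv_ofReal ℓ.differentiable, dirDeriv_clm]
  simp

theorem Tame.dirDeriv_logKernel (n : ℕ) (v : W) :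
    Tame n (dirDeriv v (logKernel μ ν ℓ α β L)) := by
  rw [TodaD.dirDeriv_logKernel]
  exact ((Tame.const n _).add (((Tame.const n _).add
    ((Tame.sigmoid_clm n (α - β)).const_mul _)).const_mul ν)).sub (Tame.expSum n _ L)

theorem dirDeriv_dirDeriv_logKernel (v : W) :
    dirDeriv v (dirDeriv v (logKernel μ ν ℓ α β L)) = fun w =>
      ν * ((α v - β v) ^ 2 *
        (Real.sigmoid ((α - β) w) * (1 - Real.sigmoid ((α - β) w))))
        - expSum (fun i => (L i v : ℂ) ^ 2) L w := by
  have hσ := differentiable_sigmoid_clm (α - β)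
  rw [dirDeriv_logKernel, dirDeriv_sub (by fun_prop) (Tame.expSum 1 _ L).differentiable,
    dirDeriv_add (by fun_prop) (by fun_prop), dirDeriv_const,
    dirDeriv_const_mul (by fun_prop), dirDeriv_add (by fun_prop) (by fun_prop), dirDeriv_const,
    dirDeriv_const_mul hσ, dirDeriv_sigmoid_clm, dirDeriv_expSum]
  funext w
  simp only [sub_apply, Complex.ofReal_sub, ← pow_two]
  ring

theorem differentiable_expKernel : Differentiable ℝ (expKernel c μ ν ℓ α β L) :=
  (differentiable_logKernel μ ν ℓ α β L).cexp.const_mul c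

theorem dirDeriv_expKernel (v : W) :
    dirDeriv v (expKernel c μ ν ℓ α β L) = fun w =>
      dirDeriv v (logKernel μ ν ℓ α β L) w * expKernel c μ ν ℓ α β L w := by
  have hlog := differentiable_logKernel μ ν ℓ α β L
  change dirDeriv v (fun w => c * Complex.exp (logKernel μ ν ℓ α β L w)) = _
  rw [dirDeriv_const_mul hlog.cexp, dirDeriv_cexp hlog]
  simp only [expKernel, mul_left_comm]

theorem dirDeriv_dirDeriv_expKernel (v : W) :
    dirDeriv v (dirDeriv v (expKernel c μ ν ℓ α β L)) = fun w =>
      (dirDeriv v (dirDeriv v (logKernel μ ν ℓ α β L)) w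
        + dirDeriv v (logKernel μ ν ℓ α β L) w ^ 2) * expKernel c μ ν ℓ α β L w := by
  rw [dirDeriv_expKernel, dirDeriv_mul (Tame.dirDeriv_logKernel μ ν ℓ α β L 1 v).differentiable
    (differentiable_expKernel c μ ν ℓ α β L), dirDeriv_expKernel]
  funext w
  ring

end ExponentialKernel

section RapidExpKernel

variable {E Y : Type*} [NormedAddCommGroup E] [NormedSpace ℝ E]
  [NormedAddCommGroup Y] [NormedSpace ℝ Y] {ι : Type*} [Fintype ι]

theorem Rapid.expKernel (n : ℕ) (c μ ν : ℂ) (ℓ α β : E × Y →L[ℝ] ℝ) {L : ι → E × Y →L[ℝ] ℝ}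
    (hL : RapidlyDecaying (fun w => Real.exp (-∑ i, Real.exp (L i w)))) :
    Rapid n (expKernel c μ ν ℓ α β L) := by
  have hdecay : RapidlyDecaying (fun w => Complex.exp (-TodaD.expSum (fun _ => 1) L w)) :=
    hL.mono fun w => by
      simp [Complex.norm_exp, TodaD.expSum, ← Complex.ofReal_exp]
  have hbound : RapidlyDecaying (TodaD.expKernel c μ ν ℓ α β L) := by
    refine ((((ExpBounded.const c).mul (Tame.cexp_const_mul_clm 0 μ ℓ).bound).mul
      (.cexp_const_mul_logAddExp ν α β)).mul_rapidlyDecaying hdecay).mono fun w => le_of_eq ?_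
    rw [TodaD.expKernel, logKernel, sub_eq_add_neg, Complex.exp_add, Complex.exp_add]
    simp only [mul_assoc]
  exact ControlledBy.of_dirDeriv_eq_mul RapidlyDecaying.add ExpBounded.mul_rapidlyDecaying
    (differentiable_expKernel c μ ν ℓ α β L) hbound (Tame.dirDeriv_logKernel μ ν ℓ α β L)
    (dirDeriv_expKernel c μ ν ℓ α β L) n

end RapidExpKernel

/-! ### The integrand of the recursive kernel -/

section Decay

variable {E Y : Type*} [NormedAddCommGroup E] [NormedSpace ℝ E]
  [NormedAddCommGroup Y] [NormedSpace ℝ Y] {ι : Type*} [Fintype ι]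

theorem rapidlyDecaying_exp_neg_sum_exp {L : ι → E × Y →L[ℝ] ℝ} {A N : ℝ}
    (hL : ∀ x y S, 0 ≤ S → (∀ i, L i (x, y) ≤ S) → ‖y‖ ≤ A * ‖x‖ + N * S) :
    RapidlyDecaying (fun w => Real.exp (-∑ i, Real.exp (L i w))) := by
  intro B
  obtain ⟨n, hn⟩ := exists_nat_ge (|B| * N)
  refine ⟨n.factorial * Real.exp 1, |B| * A, fun x y => ?_⟩
  set V := ∑ i, Real.exp (L i (x, y))
  have hV0 : 0 ≤ V := Finset.sum_nonneg fun i _ => (Real.exp_pos _).le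
  set S := Real.log (1 + V) with hS
  have hS0 : 0 ≤ S := Real.log_nonneg (by linarith)
  have hexpS : Real.exp (n * S) = (1 + V) ^ n := by
    rw [Real.exp_nat_mul, hS, Real.exp_log (by linarith)]
  have hy : ‖y‖ ≤ A * ‖x‖ + N * S := hL x y S hS0 fun i => by
    rw [hS, Real.le_log_iff_exp_le (by linarith)]
    have hle : Real.exp (L i (x, y)) ≤ V :=
      Finset.single_le_sum (fun i _ => (Real.exp_pos (L i (x, y))).le) (Finset.mem_univ i)
    linarith
  have hexponent : -(n * S) ≤ |B| * A * ‖x‖ - B * ‖y‖ := by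
    have hBy : B * ‖y‖ ≤ |B| * (A * ‖x‖ + N * S) := by gcongr; exact le_abs_self B
    nlinarith [mul_le_mul_of_nonneg_right hn hS0]
  have hpow : (1 + V) ^ n ≤ n.factorial * Real.exp (1 + V) := by
    rw [← div_le_iff₀' (by positivity)]
    exact Real.pow_div_factorial_le_exp (1 + V) (by linarith) n
  rw [Real.norm_of_nonneg (Real.exp_pos _).le]
  calc Real.exp (-V) = Real.exp (-V) * Real.exp (-(n * S)) * (1 + V) ^ n := by
        rw [← hexpS, mul_assoc, ← Real.exp_add (-(n * S)), neg_add_cancel, Real.exp_zero, mul_one]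
    _ ≤ Real.exp (-V) * Real.exp (-(n * S)) * (n.factorial * Real.exp (1 + V)) := by gcongr
    _ = n.factorial * Real.exp 1 * Real.exp (-(n * S)) := by
        rw [Real.exp_add, Real.exp_neg V]
        field_simp
    _ ≤ n.factorial * Real.exp 1 * Real.exp (|B| * A * ‖x‖ - B * ‖y‖) := by gcongr

end Decay

section TodaKernel

/-- The variables `(x, (x', t))` of the integrand of the recursive kernel. -/
abbrev Coords (r : ℕ) : Type :=
  (Fin (r + 2) → ℝ) × ((Fin (r + 1) → ℝ) × (Fin (r + 1) → ℝ))

variable {r : ℕ}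

/-- The coordinate `x_j`. -/
def xCoord (j : Fin (r + 2)) : Coords r →L[ℝ] ℝ :=
  (ContinuousLinearMap.proj j).comp (.fst ℝ _ _)

/-- The coordinate `x'_i`, abbreviated to `u_i`. -/
def uCoord (i : Fin (r + 1)) : Coords r →L[ℝ] ℝ :=
  (ContinuousLinearMap.proj i).comp ((ContinuousLinearMap.fst ℝ _ _).comp (.snd ℝ _ _))

/-- The coordinate `t_i = z_i - iπ`. -/
def tCoord (i : Fin (r + 1)) : Coords r →L[ℝ] ℝ :=
  (ContinuousLinearMap.proj i).comp ((ContinuousLinearMap.snd ℝ _ _).comp (.snd ℝ _ _))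

@[simp] theorem xCoord_apply (j : Fin (r + 2)) (w : Coords r) : xCoord j w = w.1 j := rfl

@[simp] theorem uCoord_apply (i : Fin (r + 1)) (w : Coords r) : uCoord i w = w.2.1 i := rfl

@[simp] theorem tCoord_apply (i : Fin (r + 1)) (w : Coords r) : tCoord i w = w.2.2 i := rfl

/-- The exponents of `Q_{D_{r+2}}^{C_{r+1}}(x; z)`, in the order in which they occur there. -/
def dcForm : Fin (r + 1) ⊕ Fin (r + 1) ⊕ Unit → Coords r →L[ℝ] ℝ
  | .inl i => tCoord i - xCoord i.castSucc
  | .inr (.inl i) => xCoord i.succ - tCoord i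
  | .inr (.inr _) => -xCoord (Fin.last (r + 1)) - tCoord (Fin.last r)

/-- The exponents of `Q_{C_{r+1}}^{D_{r+1}}(z; x')`. -/
def cdForm : Fin (r + 1) ⊕ Fin r ⊕ Unit → Coords r →L[ℝ] ℝ
  | .inl i => uCoord i - tCoord i
  | .inr (.inl i) => tCoord i.succ - uCoord i.castSucc
  | .inr (.inr _) => -uCoord (Fin.last r) - tCoord (Fin.last r)

/-- The linear form `∑ x_j + ∑ x'_i - 2 ∑ t_i`. -/
def sumForm : Coords r →L[ℝ] ℝ := ∑ j, xCoord j + ∑ i, uCoord i - (2 : ℝ) • ∑ i, tCoord i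

/-- The integrand of the recursive kernel as a function of all its variables. The constant and the
signs of the exponential terms come from the shift of the contour by `iπ`. -/
def todaKernel (lam : ℂ) : Coords r → ℂ :=
  expKernel (Complex.exp (2 * Real.pi * (r + 1) * lam)) (Complex.I * lam) (2 * (Complex.I * lam))
    sumForm (-xCoord (Fin.last (r + 1))) (-uCoord (Fin.last r)) (Sum.elim dcForm cdForm)

theorem cexp_add_pi_mul_I_sub (z w : ℂ) :
    Complex.exp (z + Real.pi * Complex.I - w) = -Complex.exp (z - w) := by
  rw [add_sub_right_comm, Complex.exp_add, Complex.exp_pi_mul_I, mul_neg_one]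

theorem cexp_sub_add_pi_mul_I (z w : ℂ) :
    Complex.exp (w - (z + Real.pi * Complex.I)) = -Complex.exp (w - z) := by
  rw [← sub_sub, Complex.exp_sub, Complex.exp_pi_mul_I, div_neg, div_one]

theorem kernelDC_zContour (x : Fin (r + 2) → ℝ) (u t : Fin (r + 1) → ℝ) :
    kernelDC r x (zContour t) = Complex.exp (-expSum (fun _ => 1) dcForm (x, (u, t))) := by
  simp only [kernelDC, zContour, cexp_add_pi_mul_I_sub, cexp_sub_add_pi_mul_I, expSum, dcForm,
    Fintype.sum_sum_type, Finset.sum_add_distrib, Finset.sum_neg_distrib]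
  congr 1
  simp only [sub_apply, tCoord_apply, xCoord_apply, Complex.ofReal_sub, one_mul, Finset.univ_unique,
    PUnit.default_eq_unit, neg_apply, Complex.ofReal_neg, Finset.sum_const, Finset.card_singleton,
    one_smul, neg_add_rev]
  ring

theorem kernelCD_zContour (x : Fin (r + 2) → ℝ) (u t : Fin (r + 1) → ℝ) :
    kernelCD r (zContour t) u = Complex.exp (-expSum (fun _ => 1) cdForm (x, (u, t))) := by
  simp only [kernelCD, zContour, cexp_add_pi_mul_I_sub, cexp_sub_add_pi_mul_I, expSum, cdForm,
    Fintype.sum_sum_type, Finset.sum_add_distrib, Finset.sum_neg_distrib, Fin.sum_univ_castSucc]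
  congr 1
  simp only [sub_apply, uCoord_apply, tCoord_apply, Complex.ofReal_sub, one_mul, Finset.univ_unique,
    PUnit.default_eq_unit, neg_apply, Complex.ofReal_neg, Finset.sum_const, Finset.card_singleton,
    one_smul, neg_add_rev]
  ring

theorem recIntegrand_eq_todaKernel (lam : ℂ) (x : Fin (r + 2) → ℝ) (u t : Fin (r + 1) → ℝ) :
    recIntegrand r lam x u t = todaKernel lam (x, (u, t)) := by
  have hpos : 0 < Real.exp (-x (Fin.last (r + 1))) + Real.exp (-u (Fin.last r)) := by positivity
  rw [recIntegrand, todaKernel, expKernel, logKernel, kernelDC_zContour x u, kernelCD_zContour x,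
    Complex.cpow_def_of_ne_zero (by exact_mod_cast hpos.ne'), ← Complex.ofReal_log hpos.le]
  simp only [← Complex.exp_add]
  congr 1
  simp only [zContour, Finset.sum_add_distrib, Finset.sum_const, Finset.card_univ, Fintype.card_fin,
    nsmul_eq_mul, Nat.cast_add, Nat.cast_one, expSum, one_mul, Fintype.sum_sum_type,
    Finset.univ_unique, PUnit.default_eq_unit, Finset.sum_singleton, neg_add_rev, sumForm,
    sub_apply, add_apply, sum_apply, xCoord_apply, uCoord_apply, smul_apply, tCoord_apply,
    smul_eq_mul, Complex.ofReal_sub, Complex.ofReal_add, Complex.ofReal_sum, Complex.ofReal_mul,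
    Complex.ofReal_ofNat, logAddExp, neg_apply, Sum.elim_inl, Sum.elim_inr]
  linear_combination (-2 * lam * (r + 1) * Real.pi) * Complex.I_sq

theorem norm_le_of_forms_le {x : Fin (r + 2) → ℝ} {y : (Fin (r + 1) → ℝ) × (Fin (r + 1) → ℝ)}
    {S : ℝ} (hS : 0 ≤ S) (hdc : ∀ k, dcForm k (x, y) ≤ S) (hcd : ∀ k, cdForm k (x, y) ≤ S) :
    ‖y‖ ≤ ‖x‖ + 2 * S := by
  have hx : ∀ j, |x j| ≤ ‖x‖ := norm_le_pi_norm x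
  have ht : ∀ i, |y.2 i| ≤ ‖x‖ + S := fun i => by
    have ha : y.2 i - x i.castSucc ≤ S := hdc (.inl i)
    have hb : x i.succ - y.2 i ≤ S := hdc (.inr (.inl i))
    rw [abs_le]
    constructor <;> linarith [abs_le.1 (hx i.castSucc), abs_le.1 (hx i.succ)]
  have hu : ∀ i, |y.1 i| ≤ ‖x‖ + 2 * S := fun i => by
    have hd : y.1 i - y.2 i ≤ S := hcd (.inl i)
    refine abs_le.2 ⟨?_, by linarith [abs_le.1 (ht i)]⟩
    induction i using Fin.lastCases with
    | last =>
      have hh : -y.1 (Fin.last r) - y.2 (Fin.last r) ≤ S := hcd (.inr (.inr ()))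
      linarith [abs_le.1 (ht (Fin.last r))]
    | cast i =>
      have hg : y.2 i.succ - y.1 i.castSucc ≤ S := hcd (.inr (.inl i))
      linarith [abs_le.1 (ht i.succ)]
  have hnonneg : 0 ≤ ‖x‖ + 2 * S := by positivity
  exact max_le ((pi_norm_le_iff_of_nonneg hnonneg).2 hu)
    ((pi_norm_le_iff_of_nonneg hnonneg).2 fun i => (ht i).trans (by linarith))

theorem rapid_todaKernel (n : ℕ) (lam : ℂ) : Rapid n (todaKernel (r := r) lam) :=
  Rapid.expKernel n _ _ _ _ _ _ <|
    rapidlyDecaying_exp_neg_sum_exp (A := 1) (N := 2) fun x y S hS h => by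
      rw [one_mul]
      exact norm_le_of_forms_le hS (fun k => h (.inl k)) fun k => h (.inr k)

end TodaKernel

/-! ### The intertwining relation -/

section Intertwining

variable {r : ℕ}

/-- The unit vector in the direction of `x_j`. -/
def xDir (j : Fin (r + 2)) : Coords r := (Pi.single j 1, 0)

/-- The unit vector in the direction of `x'_i`. -/
def uDir (i : Fin (r + 1)) : Coords r := (0, (Pi.single i 1, 0))

/-- The unit vector in the direction of `t_i`. -/
def tDir (i : Fin (r + 1)) : Coords r := (0, (0, Pi.single i 1))

/-- The function `-log Q_{D_{r+2}}^{C_{r+1}}`, up to the shift of the contour. -/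
def dcPotential : Coords r → ℂ := expSum (fun _ => 1) dcForm

/-- The function `-log Q_{C_{r+1}}^{D_{r+1}}`, up to the shift of the contour. -/
def cdPotential : Coords r → ℂ := expSum (fun _ => 1) cdForm

/-- The exponential `e^{t_i - x_i}`. -/
def expTX (w : Coords r) (i : Fin (r + 1)) : ℂ := Complex.exp (dcForm (.inl i) w)

/-- The exponential `e^{x_{i+1} - t_i}`. -/
def expXT (w : Coords r) (i : Fin (r + 1)) : ℂ := Complex.exp (dcForm (.inr (.inl i)) w)

/-- The boundary exponential `e^{-x_{r+2} - t_{r+1}}`. -/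
def expNegXT (w : Coords r) : ℂ := Complex.exp (dcForm (.inr (.inr ())) w)

/-- The exponential `e^{x'_i - t_i}`. -/
def expUT (w : Coords r) (i : Fin (r + 1)) : ℂ := Complex.exp (cdForm (.inl i) w)

/-- The exponential `e^{t_{i+1} - x'_i}`. -/
def expTU (w : Coords r) (i : Fin r) : ℂ := Complex.exp (cdForm (.inr (.inl i)) w)

/-- The boundary exponential `e^{-x'_{r+1} - t_{r+1}}`. -/
def expNegUT (w : Coords r) : ℂ := Complex.exp (cdForm (.inr (.inr ())) w)

theorem sum_ite_castSucc_eq {n : ℕ} (f : Fin n → ℂ) (j : Fin (n + 1)) :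
    ∑ i : Fin n, (if i.castSucc = j then f i else 0) = (Fin.snoc f 0 : Fin (n + 1) → ℂ) j := by
  cases j using Fin.lastCases with
  | last => simp [Fin.castSucc_ne_last]
  | cast j => simp

theorem sum_ite_succ_eq {n : ℕ} (f : Fin n → ℂ) (j : Fin (n + 1)) :
    ∑ i : Fin n, (if i.succ = j then f i else 0) = (Fin.cons 0 f : Fin (n + 1) → ℂ) j := by
  cases j using Fin.cases with
  | zero => simp [Fin.succ_ne_zero]
  | succ j => simp

theorem dirDeriv_xDir_dcPotential (j : Fin (r + 2)) (w : Coords r) :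
    dirDeriv (xDir j) dcPotential w
      = (Fin.cons 0 (expXT w) : Fin (r + 2) → ℂ) j - (Fin.snoc (expTX w) 0 : Fin (r + 2) → ℂ) j
        - if j = Fin.last (r + 1) then expNegXT w else 0 := by
  rw [dcPotential, dirDeriv_expSum, ← sum_ite_castSucc_eq, ← sum_ite_succ_eq]
  simp [expSum, Fintype.sum_sum_type, xDir, dcForm, Pi.single_apply,
    apply_ite Complex.ofReal, expTX, expXT, expNegXT, eq_comm (a := Fin.last _)]
  ring

theorem dirDeriv_uDir_cdPotential (i : Fin (r + 1)) (w : Coords r) :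
    dirDeriv (uDir i) cdPotential w
      = expUT w i - (Fin.snoc (expTU w) 0 : Fin (r + 1) → ℂ) i
        - if i = Fin.last r then expNegUT w else 0 := by
  rw [cdPotential, dirDeriv_expSum, ← sum_ite_castSucc_eq]
  simp [expSum, Fintype.sum_sum_type, uDir, cdForm, Pi.single_apply,
    apply_ite Complex.ofReal, expTU, expUT, expNegUT, eq_comm (a := Fin.last _)]
  ring

theorem dirDeriv_tDir_dcPotential (i : Fin (r + 1)) (w : Coords r) :
    dirDeriv (tDir i) dcPotential w
      = expTX w i - expXT w i - if i = Fin.last r then expNegXT w else 0 := by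
  rw [dcPotential, dirDeriv_expSum]
  simp [expSum, Fintype.sum_sum_type, tDir, dcForm, Pi.single_apply,
    apply_ite Complex.ofReal, expTX, expXT, expNegXT, eq_comm (a := Fin.last _)]
  ring

theorem dirDeriv_tDir_cdPotential (i : Fin (r + 1)) (w : Coords r) :
    dirDeriv (tDir i) cdPotential w
      = (Fin.cons 0 (expTU w) : Fin (r + 1) → ℂ) i - expUT w i
        - if i = Fin.last r then expNegUT w else 0 := by
  rw [cdPotential, dirDeriv_expSum, ← sum_ite_succ_eq]
  simp [expSum, Fintype.sum_sum_type, tDir, cdForm, Pi.single_apply,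
    apply_ite Complex.ofReal, expTU, expUT, expNegUT, eq_comm (a := Fin.last _)]
  ring

theorem sum_sq_dcForm_xDir (k : Fin (r + 1) ⊕ Fin (r + 1) ⊕ Unit) :
    ∑ j, (dcForm k (xDir j) : ℂ) ^ 2 = 1 := by
  rcases k with i | i | _ <;> simp [dcForm, xDir, Pi.single_apply,
    apply_ite Complex.ofReal, ite_pow]

theorem sum_sq_dcForm_tDir (k : Fin (r + 1) ⊕ Fin (r + 1) ⊕ Unit) :
    ∑ i, (dcForm k (tDir i) : ℂ) ^ 2 = 1 := by
  rcases k with i | i | _ <;> simp [dcForm, tDir, Pi.single_apply,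
    apply_ite Complex.ofReal, ite_pow]

theorem sum_sq_cdForm_uDir (k : Fin (r + 1) ⊕ Fin r ⊕ Unit) :
    ∑ i, (cdForm k (uDir i) : ℂ) ^ 2 = 1 := by
  rcases k with i | i | _ <;> simp [cdForm, uDir, Pi.single_apply,
    apply_ite Complex.ofReal, ite_pow]

theorem sum_sq_cdForm_tDir (k : Fin (r + 1) ⊕ Fin r ⊕ Unit) :
    ∑ i, (cdForm k (tDir i) : ℂ) ^ 2 = 1 := by
  rcases k with i | i | _ <;> simp [cdForm, tDir, Pi.single_apply,
    apply_ite Complex.ofReal, ite_pow]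

theorem sum_add_ite_eq {ι : Type*} [Fintype ι] [DecidableEq ι] (f : ι → ℂ) (k : ι) (ε : ℂ) :
    ∑ i, (f i + if i = k then ε else 0) = ∑ i, f i + ε := by
  simp [Finset.sum_add_distrib]

theorem sum_add_ite_eq_sq {ι : Type*} [Fintype ι] [DecidableEq ι] (f : ι → ℂ) (k : ι) (ε : ℂ) :
    ∑ i, (f i + if i = k then ε else 0) ^ 2 = ∑ i, f i ^ 2 + (2 * ε * f k + ε ^ 2) := by
  rw [← sum_add_ite_eq _ k]
  refine Finset.sum_congr rfl fun i _ => ?_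
  split_ifs with hi
  · rw [hi]
    ring
  · ring

theorem sum_const_add_sub_sq {ι : Type*} [Fintype ι] (μ : ℂ) (f g : ι → ℂ) :
    ∑ i, (μ + f i - g i) ^ 2 = Fintype.card ι * μ ^ 2 + 2 * μ * (∑ i, f i - ∑ i, g i)
      + ∑ i, f i ^ 2 + ∑ i, g i ^ 2 - 2 * ∑ i, f i * g i := by
  calc ∑ i, (μ + f i - g i) ^ 2
      = ∑ i, (μ ^ 2 + 2 * μ * (f i - g i) + f i ^ 2 + g i ^ 2 - 2 * (f i * g i)) :=
        Finset.sum_congr rfl fun i _ => by ring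
    _ = _ := by
        simp [Finset.sum_add_distrib, Finset.sum_sub_distrib, ← Finset.mul_sum]

theorem sum_snoc_zero {n : ℕ} (a : Fin n → ℂ) :
    ∑ j, (Fin.snoc a 0 : Fin (n + 1) → ℂ) j = ∑ i, a i := by
  simp [Fin.sum_univ_castSucc]

theorem sum_snoc_zero_sq {n : ℕ} (a : Fin n → ℂ) :
    ∑ j, (Fin.snoc a 0 : Fin (n + 1) → ℂ) j ^ 2 = ∑ i, a i ^ 2 := by
  simp [Fin.sum_univ_castSucc]

theorem sum_cons_zero {n : ℕ} (b : Fin n → ℂ) :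
    ∑ j, (Fin.cons 0 b : Fin (n + 1) → ℂ) j = ∑ i, b i := by
  simp [Fin.sum_univ_succ]

theorem sum_cons_zero_sq {n : ℕ} (b : Fin n → ℂ) :
    ∑ j, (Fin.cons 0 b : Fin (n + 1) → ℂ) j ^ 2 = ∑ i, b i ^ 2 := by
  simp [Fin.sum_univ_succ]

theorem sum_snoc_zero_mul {n : ℕ} (g : Fin n → ℂ) (d : Fin (n + 1) → ℂ) :
    ∑ i, (Fin.snoc g 0 : Fin (n + 1) → ℂ) i * d i = ∑ j, g j * d j.castSucc := by
  simp [Fin.sum_univ_castSucc]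

theorem sum_snoc_zero_mul_cons_zero {n : ℕ} (a b : Fin (n + 1) → ℂ) :
    ∑ j, (Fin.snoc a 0 : Fin (n + 2) → ℂ) j * (Fin.cons 0 b : Fin (n + 2) → ℂ) j
      = ∑ j : Fin n, a j.succ * b j.castSucc := by
  rw [sum_snoc_zero_mul, Fin.sum_univ_succ]
  simp only [Fin.castSucc_zero, Fin.cons_zero, mul_zero, zero_add, ← Fin.succ_castSucc,
    Fin.cons_succ]

theorem dc_squares_cancel {n : ℕ} (μ p c : ℂ) (a b : Fin (n + 1) → ℂ) :
    -(1 / 2) * ∑ j, (μ + (Fin.snoc a 0 : Fin (n + 2) → ℂ) j - (Fin.cons 0 b : Fin (n + 2) → ℂ) j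
          + if j = Fin.last (n + 1) then c - 2 * μ * p else 0) ^ 2
        + (∑ i, a i * b i + a (Fin.last n) * c)
        + ((∑ i, (a i - b i + if i = Fin.last n then -c else 0) ^ 2) / 2
          + μ * ∑ i, (a i - b i + if i = Fin.last n then -c else 0))
      = ∑ j : Fin n, a j.succ * b j.castSucc - (n + 2) / 2 * μ ^ 2 + 2 * μ ^ 2 * (p * (1 - p))
        - 2 * μ * p * (b (Fin.last n) - c) - 2 * μ * c + 2 * b (Fin.last n) * c := by
  have hsq := sum_const_add_sub_sq 0 a b
  simp only [zero_add] at hsq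
  rw [sum_add_ite_eq_sq, sum_add_ite_eq_sq, sum_add_ite_eq, Finset.sum_sub_distrib, hsq,
    sum_const_add_sub_sq, sum_snoc_zero, sum_snoc_zero_sq, sum_cons_zero, sum_cons_zero_sq,
    sum_snoc_zero_mul_cons_zero, Fin.snoc_last, ← Fin.succ_last, Fin.cons_succ, Fintype.card_fin]
  push_cast
  ring

theorem cd_squares_cancel {n : ℕ} (μ q h : ℂ) (d : Fin (n + 1) → ℂ) (g : Fin n → ℂ) :
    -(1 / 2) * ∑ i, (μ + (Fin.snoc g 0 : Fin (n + 1) → ℂ) i - d i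
          + if i = Fin.last n then h - 2 * μ * q else 0) ^ 2
        + (∑ i, (Fin.cons 0 g : Fin (n + 1) → ℂ) i * d i
          + (Fin.cons 0 g : Fin (n + 1) → ℂ) (Fin.last n) * h)
        + ((∑ i, ((Fin.cons 0 g : Fin (n + 1) → ℂ) i - d i
            + if i = Fin.last n then -h else 0) ^ 2) / 2
          + μ * ∑ i, ((Fin.cons 0 g : Fin (n + 1) → ℂ) i - d i
            + if i = Fin.last n then -h else 0))
      = ∑ j : Fin n, g j * d j.castSucc - (n + 1) / 2 * μ ^ 2 + 2 * μ ^ 2 * (q * (1 - q))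
        - 2 * μ * q * (d (Fin.last n) - h) - 2 * μ * h + 2 * d (Fin.last n) * h := by
  have hsq := sum_const_add_sub_sq 0 (Fin.cons 0 g : Fin (n + 1) → ℂ) d
  simp only [zero_add] at hsq
  rw [sum_add_ite_eq_sq, sum_add_ite_eq_sq, sum_add_ite_eq, Finset.sum_sub_distrib, hsq,
    sum_const_add_sub_sq, sum_snoc_zero, sum_snoc_zero_sq, sum_cons_zero, sum_cons_zero_sq,
    sum_snoc_zero_mul, Fin.snoc_last, Fintype.card_fin]
  push_cast
  ring

theorem expSum_sumElim {W ι κ : Type*} [NormedAddCommGroup W] [NormedSpace ℝ W] [Fintype ι]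
    [Fintype κ] (c : ι ⊕ κ → ℂ) (L : ι → W →L[ℝ] ℝ) (M : κ → W →L[ℝ] ℝ) (w : W) :
    expSum c (Sum.elim L M) w = expSum (c ∘ .inl) L w + expSum (c ∘ .inr) M w :=
  Fintype.sum_sum_type _

theorem sum_dirDeriv_dirDeriv_expSum {W ι κ : Type*} [NormedAddCommGroup W] [NormedSpace ℝ W]
    [Fintype ι] [Fintype κ] (c : ι → ℂ) (L : ι → W →L[ℝ] ℝ) (v : κ → W) (w : W) :
    ∑ k, dirDeriv (v k) (dirDeriv (v k) (expSum c L)) w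
      = expSum (fun i => c i * ∑ k, (L i (v k) : ℂ) ^ 2) L w := by
  simp only [dirDeriv_expSum, expSum, Finset.mul_sum, Finset.sum_mul]
  rw [Finset.sum_comm]
  simp only [pow_two, mul_assoc]

theorem sum_dirDeriv_dirDeriv_xDir_dcPotential (w : Coords r) :
    ∑ j, dirDeriv (xDir j) (dirDeriv (xDir j) dcPotential) w = dcPotential w := by
  simp only [dcPotential, sum_dirDeriv_dirDeriv_expSum, sum_sq_dcForm_xDir, mul_one]

theorem sum_dirDeriv_dirDeriv_tDir_dcPotential (w : Coords r) :
    ∑ i, dirDeriv (tDir i) (dirDeriv (tDir i) dcPotential) w = dcPotential w := by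
  simp only [dcPotential, sum_dirDeriv_dirDeriv_expSum, sum_sq_dcForm_tDir, mul_one]

theorem sum_dirDeriv_dirDeriv_uDir_cdPotential (w : Coords r) :
    ∑ i, dirDeriv (uDir i) (dirDeriv (uDir i) cdPotential) w = cdPotential w := by
  simp only [cdPotential, sum_dirDeriv_dirDeriv_expSum, sum_sq_cdForm_uDir, mul_one]

theorem sum_dirDeriv_dirDeriv_tDir_cdPotential (w : Coords r) :
    ∑ i, dirDeriv (tDir i) (dirDeriv (tDir i) cdPotential) w = cdPotential w := by
  simp only [cdPotential, sum_dirDeriv_dirDeriv_expSum, sum_sq_cdForm_tDir, mul_one]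

theorem dirDeriv_xDir_cdPotential (j : Fin (r + 2)) :
    dirDeriv (xDir j) cdPotential = fun _ => 0 := by
  have hzero : ∀ k, cdForm k (xDir j) = 0 := by rintro (i | i | _) <;> simp [cdForm, xDir]
  funext w
  simp [cdPotential, dirDeriv_expSum, expSum, hzero]

theorem dirDeriv_uDir_dcPotential (i : Fin (r + 1)) :
    dirDeriv (uDir i) dcPotential = fun _ => 0 := by
  have hzero : ∀ k, dcForm k (uDir i) = 0 := by rintro (i | i | _) <;> simp [dcForm, uDir]
  funext w
  simp [dcPotential, dirDeriv_expSum, expSum, hzero]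

/-- The weight `e^{-x_{r+2}} / (e^{-x_{r+2}} + e^{-x'_{r+1}})`. -/
def lastWeight (w : Coords r) : ℂ :=
  Real.sigmoid ((-xCoord (Fin.last (r + 1)) - -uCoord (Fin.last r)) w)

theorem one_sub_lastWeight (w : Coords r) :
    1 - lastWeight w
      = lastWeight w * Complex.exp (w.1 (Fin.last (r + 1)) - w.2.1 (Fin.last r)) := by
  have hσ := Real.sigmoid_mul_rexp_neg ((-xCoord (Fin.last (r + 1)) - -uCoord (Fin.last r)) w)
  rw [Real.sigmoid_neg] at hσ
  rw [lastWeight, ← Complex.ofReal_one, ← Complex.ofReal_sub, ← hσ]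
  simp [sub_eq_add_neg, add_comm]

/-- The logarithm of `todaKernel`, up to an additive constant. -/
def todaExponent (lam : ℂ) : Coords r → ℂ :=
  logKernel (Complex.I * lam) (2 * (Complex.I * lam)) sumForm (-xCoord (Fin.last (r + 1)))
    (-uCoord (Fin.last r)) (Sum.elim dcForm cdForm)

theorem dirDeriv_todaExponent (lam : ℂ) (v w : Coords r) :
    dirDeriv v (todaExponent lam) w
      = Complex.I * lam * sumForm v
        + 2 * (Complex.I * lam) * (-v.2.1 (Fin.last r)
          + (v.2.1 (Fin.last r) - v.1 (Fin.last (r + 1))) * lastWeight w)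
        - dirDeriv v dcPotential w - dirDeriv v cdPotential w := by
  simp only [todaExponent, dirDeriv_logKernel, dcPotential, cdPotential, dirDeriv_expSum,
    expSum_sumElim, Function.comp_def, Sum.elim_inl, Sum.elim_inr, one_mul, lastWeight]
  simp only [neg_apply, uCoord_apply, Complex.ofReal_neg, xCoord_apply, sub_neg_eq_add, add_apply]
  ring

theorem dirDeriv_dirDeriv_todaExponent (lam : ℂ) (v w : Coords r) :
    dirDeriv v (dirDeriv v (todaExponent lam)) w
      = 2 * (Complex.I * lam) * ((v.2.1 (Fin.last r) - v.1 (Fin.last (r + 1))) ^ 2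
          * (lastWeight w * (1 - lastWeight w)))
        - dirDeriv v (dirDeriv v dcPotential) w - dirDeriv v (dirDeriv v cdPotential) w := by
  simp only [todaExponent, dirDeriv_dirDeriv_logKernel, dcPotential, cdPotential, dirDeriv_expSum,
    expSum_sumElim, Function.comp_def, Sum.elim_inl, Sum.elim_inr, one_mul, lastWeight, ← pow_two]
  simp only [neg_apply, xCoord_apply, Complex.ofReal_neg, uCoord_apply, sub_neg_eq_add, add_apply]
  ring

theorem sumForm_xDir (j : Fin (r + 2)) : sumForm (xDir j) = 1 := by
  simp [sumForm, xDir, Pi.single_apply]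

theorem sumForm_uDir (i : Fin (r + 1)) : sumForm (uDir i) = 1 := by
  simp [sumForm, uDir, Pi.single_apply]

theorem sumForm_tDir (i : Fin (r + 1)) : sumForm (tDir i) = -2 := by
  simp [sumForm, tDir, Pi.single_apply]

theorem dirDeriv_xDir_todaExponent (lam : ℂ) (j : Fin (r + 2)) (w : Coords r) :
    dirDeriv (xDir j) (todaExponent lam) w
      = Complex.I * lam + (Fin.snoc (expTX w) 0 : Fin (r + 2) → ℂ) j
        - (Fin.cons 0 (expXT w) : Fin (r + 2) → ℂ) j
        + if j = Fin.last (r + 1) then expNegXT w - 2 * (Complex.I * lam) * lastWeight w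
          else 0 := by
  rw [dirDeriv_todaExponent, dirDeriv_xDir_dcPotential, dirDeriv_xDir_cdPotential, sumForm_xDir]
  by_cases hj : j = Fin.last (r + 1)
  · simp only [Complex.ofReal_one, mul_one, xDir, hj, Prod.fst_zero, Pi.zero_apply,
      Complex.ofReal_zero, neg_zero, Pi.single_eq_same, zero_sub, neg_mul, one_mul, zero_add,
      mul_neg, Fin.cons_last, Fin.snoc_last, sub_zero, ↓reduceIte, add_zero]
    ring
  · simp only [Complex.ofReal_one, mul_one, xDir, Prod.fst_zero, Pi.zero_apply, Complex.ofReal_zero,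
      neg_zero, ne_eq, Ne.symm hj, not_false_eq_true, Pi.single_eq_of_ne, sub_self, zero_mul,
      add_zero, mul_zero, hj, ↓reduceIte, sub_zero]
    ring

theorem dirDeriv_uDir_todaExponent (lam : ℂ) (i : Fin (r + 1)) (w : Coords r) :
    dirDeriv (uDir i) (todaExponent lam) w
      = Complex.I * lam + (Fin.snoc (expTU w) 0 : Fin (r + 1) → ℂ) i - expUT w i
        + if i = Fin.last r then expNegUT w - 2 * (Complex.I * lam) * (1 - lastWeight w)
          else 0 := by
  rw [dirDeriv_todaExponent, dirDeriv_uDir_cdPotential, dirDeriv_uDir_dcPotential, sumForm_uDir]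
  by_cases hi : i = Fin.last r
  · simp only [Complex.ofReal_one, mul_one, uDir, hi, Pi.single_eq_same, Pi.zero_apply,
      Complex.ofReal_zero, sub_zero, one_mul, Fin.snoc_last, ↓reduceIte, add_zero]
    ring
  · simp only [Complex.ofReal_one, mul_one, uDir, ne_eq, Ne.symm hi, not_false_eq_true,
      Pi.single_eq_of_ne, Complex.ofReal_zero, neg_zero, Pi.zero_apply, sub_self, zero_mul,
      add_zero, mul_zero, sub_zero, hi, ↓reduceIte]
    ring

theorem dirDeriv_tDir_todaExponent (lam : ℂ) (i : Fin (r + 1)) (w : Coords r) :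
    dirDeriv (tDir i) (todaExponent lam) w
      = -2 * (Complex.I * lam) - dirDeriv (tDir i) dcPotential w
        - dirDeriv (tDir i) cdPotential w := by
  rw [dirDeriv_todaExponent, sumForm_tDir]
  simp only [Complex.ofReal_neg, Complex.ofReal_ofNat, mul_neg, tDir, Pi.zero_apply,
    Complex.ofReal_zero, neg_zero, sub_self, zero_mul, add_zero, mul_zero, neg_mul, sub_left_inj,
    neg_inj]
  ring

theorem dirDeriv_todaKernel (lam : ℂ) (v : Coords r) :
    dirDeriv v (todaKernel lam) = fun w => dirDeriv v (todaExponent lam) w * todaKernel lam w :=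
  dirDeriv_expKernel _ _ _ _ _ _ _ v

theorem dirDeriv_dirDeriv_todaKernel (lam : ℂ) (v : Coords r) :
    dirDeriv v (dirDeriv v (todaKernel lam)) = fun w =>
      (dirDeriv v (dirDeriv v (todaExponent lam)) w + dirDeriv v (todaExponent lam) w ^ 2)
        * todaKernel lam w :=
  dirDeriv_dirDeriv_expKernel _ _ _ _ _ _ _ v

theorem sum_dirDeriv_dirDeriv_xDir_todaKernel (lam : ℂ) (w : Coords r) :
    ∑ j, dirDeriv (xDir j) (dirDeriv (xDir j) (todaKernel lam)) w
      = (∑ j, dirDeriv (xDir j) (todaExponent lam) w ^ 2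
        + 2 * (Complex.I * lam) * (lastWeight w * (1 - lastWeight w)) - dcPotential w)
        * todaKernel lam w := by
  have hlast : ∑ j : Fin (r + 2), (((xDir (r := r) j).2.1 (Fin.last r) : ℂ)
      - (xDir (r := r) j).1 (Fin.last (r + 1))) ^ 2 = 1 := by
    simp [xDir, Pi.single_apply, apply_ite Complex.ofReal, ite_pow]
  simp only [dirDeriv_dirDeriv_todaKernel, ← Finset.sum_mul, Finset.sum_add_distrib,
    dirDeriv_dirDeriv_todaExponent, Finset.sum_sub_distrib, ← Finset.mul_sum, hlast,
    sum_dirDeriv_dirDeriv_xDir_dcPotential, dirDeriv_xDir_cdPotential, dirDeriv_const,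
    Finset.sum_const_zero]
  ring

theorem sum_dirDeriv_dirDeriv_uDir_todaKernel (lam : ℂ) (w : Coords r) :
    ∑ i, dirDeriv (uDir i) (dirDeriv (uDir i) (todaKernel lam)) w
      = (∑ i, dirDeriv (uDir i) (todaExponent lam) w ^ 2
        + 2 * (Complex.I * lam) * (lastWeight w * (1 - lastWeight w)) - cdPotential w)
        * todaKernel lam w := by
  have hlast : ∑ i : Fin (r + 1), (((uDir (r := r) i).2.1 (Fin.last r) : ℂ)
      - (uDir (r := r) i).1 (Fin.last (r + 1))) ^ 2 = 1 := by
    simp [uDir, Pi.single_apply, apply_ite Complex.ofReal, ite_pow]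
  simp only [dirDeriv_dirDeriv_todaKernel, ← Finset.sum_mul, Finset.sum_add_distrib,
    dirDeriv_dirDeriv_todaExponent, Finset.sum_sub_distrib, ← Finset.mul_sum, hlast,
    sum_dirDeriv_dirDeriv_uDir_cdPotential, dirDeriv_uDir_dcPotential, dirDeriv_const,
    Finset.sum_const_zero]
  ring

theorem tame_dirDeriv_dcPotential (n : ℕ) (v : Coords r) : Tame n (dirDeriv v dcPotential) :=
  (Tame.expSum (n + 1) _ _).dirDeriv v

theorem tame_dirDeriv_cdPotential (n : ℕ) (v : Coords r) : Tame n (dirDeriv v cdPotential) :=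
  (Tame.expSum (n + 1) _ _).dirDeriv v

/-- The components of the vector field in the `t` variables whose divergence measures the failure
of `todaKernel` to intertwine the Hamiltonians pointwise. -/
def flux (i : Fin (r + 1)) (w : Coords r) : ℂ :=
  (1 / 2) * (dirDeriv (tDir i) dcPotential w - dirDeriv (tDir i) cdPotential w)

theorem tame_flux (n : ℕ) (i : Fin (r + 1)) : Tame n (flux i) :=
  ((tame_dirDeriv_dcPotential n _).sub (tame_dirDeriv_cdPotential n _)).const_mul (1 / 2)

theorem dirDeriv_flux (i : Fin (r + 1)) (v : Coords r) :
    dirDeriv v (flux i) = fun w => (1 / 2) * (dirDeriv v (dirDeriv (tDir i) dcPotential) w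
      - dirDeriv v (dirDeriv (tDir i) cdPotential) w) := by
  have hdc := (tame_dirDeriv_dcPotential 1 (tDir i)).differentiable
  have hcd := (tame_dirDeriv_cdPotential 1 (tDir i)).differentiable
  change dirDeriv v (fun w => (1 / 2) * (dirDeriv (tDir i) dcPotential w
    - dirDeriv (tDir i) cdPotential w)) = _
  rw [dirDeriv_const_mul (by fun_prop), dirDeriv_sub hdc hcd]

theorem sum_dirDeriv_tDir_flux_mul_todaKernel (lam : ℂ) (w : Coords r) :
    ∑ i, dirDeriv (tDir i) (fun w => flux i w * todaKernel lam w) w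
      = ((dcPotential w - cdPotential w) / 2
        - ((∑ i, dirDeriv (tDir i) dcPotential w ^ 2) / 2
          + Complex.I * lam * ∑ i, dirDeriv (tDir i) dcPotential w)
        + ((∑ i, dirDeriv (tDir i) cdPotential w ^ 2) / 2
          + Complex.I * lam * ∑ i, dirDeriv (tDir i) cdPotential w)) * todaKernel lam w := by
  have hdiv : ∀ i, dirDeriv (tDir i) (fun w => flux i w * todaKernel lam w) w
      = ((dirDeriv (tDir i) (dirDeriv (tDir i) dcPotential) w
          - dirDeriv (tDir i) (dirDeriv (tDir i) cdPotential) w) / 2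
        - (dirDeriv (tDir i) dcPotential w ^ 2 / 2
          + Complex.I * lam * dirDeriv (tDir i) dcPotential w)
        + (dirDeriv (tDir i) cdPotential w ^ 2 / 2
          + Complex.I * lam * dirDeriv (tDir i) cdPotential w)) * todaKernel lam w := fun i => by
    rw [dirDeriv_mul (tame_flux 1 i).differentiable (rapid_todaKernel 1 lam).differentiable,
      dirDeriv_todaKernel, dirDeriv_flux]
    simp only [dirDeriv_tDir_todaExponent, flux]
    ring
  simp only [hdiv, ← Finset.sum_mul, Finset.sum_add_distrib, Finset.sum_sub_distrib,
    ← Finset.sum_div, ← Finset.mul_sum, sum_dirDeriv_dirDeriv_tDir_dcPotential,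
    sum_dirDeriv_dirDeriv_tDir_cdPotential]

/-- The potential of the Hamiltonian of rank `m + 1`. -/
def potential (m : ℕ) (x : Fin (m + 1) → ℝ) : ℝ :=
  ∑ j : Fin m, Real.exp (x j.succ - x j.castSucc) + boundaryPotential m x

theorem potential_fst (w : Coords r) :
    (potential (r + 1) w.1 : ℂ)
      = ∑ i, expTX w i * expXT w i + expTX w (Fin.last r) * expNegXT w := by
  simp only [potential, boundaryPotential, expTX, expXT, expNegXT, ← Complex.exp_add, dcForm]
  push_cast
  simp

theorem potential_snd_fst (w : Coords r) :
    (potential r w.2.1 : ℂ)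
      = ∑ i, (Fin.cons 0 (expTU w) : Fin (r + 1) → ℂ) i * expUT w i
        + (Fin.cons 0 (expTU w) : Fin (r + 1) → ℂ) (Fin.last r) * expNegUT w := by
  have hboundary : (boundaryPotential r w.2.1 : ℂ)
      = (Fin.cons 0 (expTU w) : Fin (r + 1) → ℂ) (Fin.last r) * expNegUT w := by
    cases r with
    | zero => simp [boundaryPotential]
    | succ r =>
      rw [← Fin.succ_last, Fin.cons_succ]
      simp only [boundaryPotential, expTU, expNegUT, ← Complex.exp_add, cdForm]
      push_cast
      simp
  rw [potential, Complex.ofReal_add, hboundary, Fin.sum_univ_succ]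
  simp only [Fin.cons_zero, Fin.cons_succ, zero_mul, zero_add, expTU, expUT, ← Complex.exp_add,
    cdForm]
  push_cast
  simp

theorem expTX_succ_mul_expXT_castSucc (w : Coords r) (j : Fin r) :
    expTX w j.succ * expXT w j.castSucc = expTU w j * expUT w j.castSucc := by
  simp [expTX, expXT, expTU, expUT, ← Complex.exp_add, dcForm, cdForm]

theorem expXT_last_mul_expNegXT (w : Coords r) :
    expXT w (Fin.last r) * expNegXT w = expUT w (Fin.last r) * expNegUT w := by
  rw [expXT, expNegXT, expUT, expNegUT, ← Complex.exp_add, ← Complex.exp_add]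
  congr 1
  simp only [dcForm, cdForm, sub_apply, neg_apply, xCoord_apply, uCoord_apply, tCoord_apply,
    Fin.succ_last]
  push_cast
  ring

theorem lastWeight_mul_expXT_last (w : Coords r) :
    lastWeight w * expXT w (Fin.last r) = (1 - lastWeight w) * expUT w (Fin.last r) := by
  rw [one_sub_lastWeight, mul_assoc, expXT, expUT, ← Complex.exp_add]
  congr 2
  simp [dcForm, cdForm]

theorem one_sub_lastWeight_mul_expNegXT (w : Coords r) :
    (1 - lastWeight w) * expNegXT w = lastWeight w * expNegUT w := by
  rw [one_sub_lastWeight, mul_assoc, expNegXT, expNegUT, ← Complex.exp_add]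
  congr 2
  simp only [dcForm, cdForm, sub_apply, neg_apply, xCoord_apply, uCoord_apply, tCoord_apply]
  push_cast
  ring

theorem todaKernel_intertwining (lam : ℂ) (w : Coords r) :
    -(1 / 2) * ∑ j, dirDeriv (xDir j) (dirDeriv (xDir j) (todaKernel lam)) w
        + potential (r + 1) w.1 * todaKernel lam w
      = -(1 / 2) * ∑ i, dirDeriv (uDir i) (dirDeriv (uDir i) (todaKernel lam)) w
        + potential r w.2.1 * todaKernel lam w + lam ^ 2 / 2 * todaKernel lam w
        + ∑ i, dirDeriv (tDir i) (fun w => flux i w * todaKernel lam w) w := by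
  have hdc := dc_squares_cancel (Complex.I * lam) (lastWeight w) (expNegXT w) (expTX w) (expXT w)
  have hcd := cd_squares_cancel (Complex.I * lam) (1 - lastWeight w) (expNegUT w) (expUT w)
    (expTU w)
  have htdc : ∀ i, dirDeriv (tDir i) dcPotential w
      = expTX w i - expXT w i + if i = Fin.last r then -expNegXT w else 0 := fun i => by
    rw [dirDeriv_tDir_dcPotential]
    split_ifs <;> ring
  have htcd : ∀ i, dirDeriv (tDir i) cdPotential w
      = (Fin.cons 0 (expTU w) : Fin (r + 1) → ℂ) i - expUT w i
        + if i = Fin.last r then -expNegUT w else 0 := fun i => by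
    rw [dirDeriv_tDir_cdPotential]
    split_ifs <;> ring
  simp only [← htdc, ← htcd, ← dirDeriv_xDir_todaExponent, ← dirDeriv_uDir_todaExponent,
    ← potential_fst, ← potential_snd_fst, expTX_succ_mul_expXT_castSucc] at hdc hcd
  rw [sum_dirDeriv_dirDeriv_xDir_todaKernel, sum_dirDeriv_dirDeriv_uDir_todaKernel,
    sum_dirDeriv_tDir_flux_mul_todaKernel]
  have hb := lastWeight_mul_expXT_last w
  have hc := one_sub_lastWeight_mul_expNegXT w
  have hbc := expXT_last_mul_expNegXT w
  linear_combination todaKernel lam w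
    * (hdc - hcd + 2 * hbc - 2 * Complex.I * lam * (hb + hc) - lam ^ 2 / 2 * Complex.I_sq)

end Intertwining

/-! ### The raising operator -/

section Raise

variable {r : ℕ}

instance isAddHaarMeasure_volume_prod {k l : ℕ} :
    (volume : Measure ((Fin k → ℝ) × (Fin l → ℝ))).IsAddHaarMeasure :=
  Measure.prod.instIsAddHaarMeasure volume volume

/-- The integrand of the raising operator: a function of `x'` times the integrand of the recursive
kernel. -/
def raiseIntegrand (lam : ℂ) (f : (Fin (r + 1) → ℝ) → ℂ) (w : Coords r) : ℂ :=
  f w.2.1 * todaKernel lam w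

/-- The raising operator: the integral operator with kernel `Q_{D_{r+2}}^{D_{r+1}}`, which maps
functions of `r + 1` variables to functions of `r + 2` variables. -/
def raise (lam : ℂ) (f : (Fin (r + 1) → ℝ) → ℂ) (x : Fin (r + 2) → ℝ) : ℂ :=
  ∫ y, raiseIntegrand lam f (x, y)

theorem tame_comp_snd_fst {n : ℕ} {f : (Fin (r + 1) → ℝ) → ℂ} (hf : Tame n f) :
    Tame n (fun w : Coords r => f w.2.1) :=
  hf.comp_clm ((ContinuousLinearMap.fst ℝ (Fin (r + 1) → ℝ) (Fin (r + 1) → ℝ)).comp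
    (.snd ℝ (Fin (r + 2) → ℝ) _))

theorem dirDeriv_comp_snd_fst {f : (Fin (r + 1) → ℝ) → ℂ} (hf : Differentiable ℝ f)
    (v : Coords r) :
    dirDeriv v (fun w : Coords r => f w.2.1) = fun w => dirDeriv v.2.1 f w.2.1 :=
  dirDeriv_comp_clm hf ((ContinuousLinearMap.fst ℝ (Fin (r + 1) → ℝ) (Fin (r + 1) → ℝ)).comp
    (.snd ℝ (Fin (r + 2) → ℝ) _)) v

theorem dirDeriv_comp_snd_fst_mul {f : (Fin (r + 1) → ℝ) → ℂ} (hf : Tame 1 f)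
    {g : Coords r → ℂ} (hg : Differentiable ℝ g) (v : Coords r) :
    dirDeriv v (fun w => f w.2.1 * g w) =
      fun w => f w.2.1 * dirDeriv v g w + dirDeriv v.2.1 f w.2.1 * g w := by
  rw [dirDeriv_mul (tame_comp_snd_fst hf).differentiable hg,
    dirDeriv_comp_snd_fst hf.differentiable]

theorem dirDeriv_comp_snd_fst_mul_of_eq_zero {f : (Fin (r + 1) → ℝ) → ℂ} (hf : Tame 1 f)
    {g : Coords r → ℂ} (hg : Differentiable ℝ g) {v : Coords r} (hv : v.2.1 = 0) :
    dirDeriv v (fun w => f w.2.1 * g w) = fun w => f w.2.1 * dirDeriv v g w := by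
  simp [dirDeriv_comp_snd_fst_mul hf hg, dirDeriv, hv]

theorem rapid_raiseIntegrand {n : ℕ} (lam : ℂ) {f : (Fin (r + 1) → ℝ) → ℂ} (hf : Tame n f) :
    Rapid n (raiseIntegrand lam f) :=
  (tame_comp_snd_fst hf).mul_rapid (rapid_todaKernel n lam)

theorem tame_raise {n : ℕ} (lam : ℂ) {f : (Fin (r + 1) → ℝ) → ℂ} (hf : Tame n f) :
    Tame n (raise lam f) :=
  (rapid_raiseIntegrand lam hf).tame_integral

/-- The components of the vector field in the `x'` variables that transfers the Laplacian from the
kernel to `f`. -/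
def greenFlux (lam : ℂ) (f : (Fin (r + 1) → ℝ) → ℂ) (i : Fin (r + 1)) (w : Coords r) : ℂ :=
  (1 / 2) * (dirDeriv (Pi.single i 1) f w.2.1 * todaKernel lam w
    - f w.2.1 * dirDeriv (uDir i) (todaKernel lam) w)

theorem rapid_greenFlux (lam : ℂ) {f : (Fin (r + 1) → ℝ) → ℂ} (hf : Tame 2 f)
    (i : Fin (r + 1)) : Rapid 1 (greenFlux lam f i) := by
  have hK : Rapid 2 (todaKernel (r := r) lam) := rapid_todaKernel 2 lam
  have hfirst := (tame_comp_snd_fst (hf.dirDeriv (Pi.single i 1))).mul_rapid hK.of_succ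
  have hsecond := (tame_comp_snd_fst hf.of_succ).mul_rapid (hK.dirDeriv (uDir i))
  have hsub := (Tame.const 1 (1 / 2 : ℂ)).mul_rapid
    (hfirst.add RapidlyDecaying.add ((Tame.const 1 (-1 : ℂ)).mul_rapid hsecond))
  have heq : greenFlux lam f i = _ := funext fun w => by
    rw [greenFlux, sub_eq_add_neg, ← neg_one_mul (f w.2.1 * _)]
  exact heq ▸ hsub

theorem dirDeriv_uDir_greenFlux (lam : ℂ) {f : (Fin (r + 1) → ℝ) → ℂ} (hf : Tame 2 f)
    (i : Fin (r + 1)) (w : Coords r) :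
    dirDeriv (uDir i) (greenFlux lam f i) w =
      (1 / 2) * (dirDeriv (Pi.single i 1) (dirDeriv (Pi.single i 1) f) w.2.1 * todaKernel lam w
        - f w.2.1 * dirDeriv (uDir i) (dirDeriv (uDir i) (todaKernel lam)) w) := by
  have hK : Rapid 2 (todaKernel (r := r) lam) := rapid_todaKernel 2 lam
  have hf' : Tame 1 (dirDeriv (Pi.single i 1) f) := hf.dirDeriv _
  have hK' := (hK.dirDeriv (uDir i)).differentiable
  have hfirst := ((tame_comp_snd_fst hf').mul_rapid hK.of_succ).differentiable
  have hsecond := ((tame_comp_snd_fst hf.of_succ).mul_rapid (hK.dirDeriv (uDir i))).differentiable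
  change dirDeriv (uDir i) (fun w => (1 / 2) * (dirDeriv (Pi.single i 1) f w.2.1 * todaKernel lam w
    - f w.2.1 * dirDeriv (uDir i) (todaKernel lam) w)) w = _
  rw [dirDeriv_const_mul (hfirst.fun_sub hsecond), dirDeriv_sub hfirst hsecond,
    dirDeriv_comp_snd_fst_mul hf' hK.differentiable, dirDeriv_comp_snd_fst_mul hf.of_succ hK']
  simp only [uDir]
  ring

theorem hamiltonian_eq_dirDeriv (m : ℕ) {f : (Fin (m + 1) → ℝ) → ℂ} (hf : Tame 2 f)
    (x : Fin (m + 1) → ℝ) :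
    hamiltonian m f x =
      -(1 / 2) * ∑ j, dirDeriv (Pi.single j 1) (dirDeriv (Pi.single j 1) f) x
        + potential m x * f x := by
  rw [hamiltonian, potential]
  congr 2
  refine Finset.sum_congr rfl fun j _ => ?_
  have hslice : ∀ g : (Fin (m + 1) → ℝ) → ℂ, Differentiable ℝ g → ∀ t,
      HasDerivAt (fun t => g (Function.update x j t))
        (dirDeriv (Pi.single j 1) g (Function.update x j t)) t := fun g hg t =>
    (hg _).hasFDerivAt.comp_hasDerivAt t (hasDerivAt_update x j t)
  have hderiv : deriv (fun t => f (Function.update x j t)) =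
      fun t => dirDeriv (Pi.single j 1) f (Function.update x j t) :=
    funext fun t => (hslice f hf.differentiable t).deriv
  rw [iteratedDeriv_succ, iteratedDeriv_one, hderiv,
    (hslice _ (hf.dirDeriv (Pi.single j 1)).differentiable (x j)).deriv,
    Function.update_eq_self]

theorem raiseIntegrand_intertwining (lam : ℂ) {f : (Fin (r + 1) → ℝ) → ℂ} (hf : Tame 2 f) {c : ℂ}
    (hc : ∀ u, hamiltonian r f u = c * f u) (w : Coords r) :
    -(1 / 2) * ∑ j, dirDeriv (xDir j) (dirDeriv (xDir j) (raiseIntegrand lam f)) w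
        + potential (r + 1) w.1 * raiseIntegrand lam f w
      = (c + lam ^ 2 / 2) * raiseIntegrand lam f w
        + ∑ i, dirDeriv (uDir i) (greenFlux lam f i) w
        + ∑ i, dirDeriv (tDir i) (fun w => flux i w * raiseIntegrand lam f w) w := by
  have hK : Rapid 2 (todaKernel (r := r) lam) := rapid_todaKernel 2 lam
  have hx : ∀ j, dirDeriv (xDir j) (dirDeriv (xDir j) (raiseIntegrand lam f)) w =
      f w.2.1 * dirDeriv (xDir j) (dirDeriv (xDir j) (todaKernel lam)) w := fun j => by
    have hone : dirDeriv (xDir j) (raiseIntegrand lam f) =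
        fun w => f w.2.1 * dirDeriv (xDir j) (todaKernel lam) w :=
      dirDeriv_comp_snd_fst_mul_of_eq_zero hf.of_succ hK.differentiable rfl
    rw [hone, dirDeriv_comp_snd_fst_mul_of_eq_zero hf.of_succ (hK.dirDeriv _).differentiable rfl]
  have ht : ∀ i, dirDeriv (tDir i) (fun w => flux i w * raiseIntegrand lam f w) w =
      f w.2.1 * dirDeriv (tDir i) (fun w => flux i w * todaKernel lam w) w := fun i => by
    simp only [raiseIntegrand, mul_left_comm (flux i _) (f _)]
    rw [dirDeriv_comp_snd_fst_mul_of_eq_zero hf.of_succ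
      ((tame_flux 2 i).mul_rapid hK).differentiable rfl]
  have heigen := hc w.2.1
  rw [hamiltonian_eq_dirDeriv r hf] at heigen
  simp only [hx, ht, dirDeriv_uDir_greenFlux lam hf, ← Finset.mul_sum, Finset.sum_sub_distrib,
    ← Finset.sum_mul]
  rw [raiseIntegrand]
  linear_combination f w.2.1 * todaKernel_intertwining lam w + todaKernel lam w * heigen

theorem hamiltonian_raise (lam : ℂ) {f : (Fin (r + 1) → ℝ) → ℂ} (hf : Tame 2 f) {c : ℂ}
    (hc : ∀ u, hamiltonian r f u = c * f u) (x : Fin (r + 2) → ℝ) :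
    hamiltonian (r + 1) (raise lam f) x = (c + lam ^ 2 / 2) * raise lam f x := by
  have hF := rapid_raiseIntegrand lam hf
  have hfluxF : ∀ i, Rapid 2 fun w => flux i w * raiseIntegrand lam f w := fun i =>
    (tame_flux 2 i).mul_rapid hF
  have hxx : ∀ j, dirDeriv (Pi.single j 1) (dirDeriv (Pi.single j 1) (raise lam f)) x =
      ∫ y, dirDeriv (xDir j) (dirDeriv (xDir j) (raiseIntegrand lam f)) (x, y) := fun j => by
    change dirDeriv _ (dirDeriv _ fun x => ∫ y, raiseIntegrand lam f (x, y)) x = _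
    rw [hF.dirDeriv_integral, Rapid.dirDeriv_integral (hF.dirDeriv _)]
    rfl
  have hFint := hF.integrable (μ := volume) x
  have hlaplaceInt := Rapid.integrable_sum_dirDeriv (μ := volume) (fun j => hF.dirDeriv (xDir j)) x
    xDir
  have hgreenInt := Rapid.integrable_sum_dirDeriv (μ := volume) (rapid_greenFlux lam hf) x uDir
  have hfluxInt := Rapid.integrable_sum_dirDeriv (μ := volume) hfluxF x tDir
  have hgreen : ∫ y, ∑ i, dirDeriv (uDir i) (greenFlux lam f i) (x, y) = 0 :=
    Rapid.integral_sum_dirDeriv_snd (rapid_greenFlux lam hf) x fun i => (Pi.single i 1, 0)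
  have hflux :
      ∫ y, ∑ i, dirDeriv (tDir i) (fun w => flux i w * raiseIntegrand lam f w) (x, y) = 0 :=
    Rapid.integral_sum_dirDeriv_snd hfluxF x fun i => (0, Pi.single i 1)
  rw [hamiltonian_eq_dirDeriv (r + 1) (tame_raise lam hf)]
  simp only [hxx]
  calc _ = ∫ y, (-(1 / 2) * ∑ j, dirDeriv (xDir j) (dirDeriv (xDir j) (raiseIntegrand lam f)) (x, y)
        + potential (r + 1) x * raiseIntegrand lam f (x, y)) := by
        rw [integral_add (hlaplaceInt.const_mul _) (hFint.const_mul _), integral_const_mul,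
          integral_const_mul, integral_finsetSum _ fun j _ =>
            Rapid.integrable ((hF.dirDeriv (xDir j)).dirDeriv (xDir j)) x]
        rfl
    _ = ∫ y, ((c + lam ^ 2 / 2) * raiseIntegrand lam f (x, y)
        + ∑ i, dirDeriv (uDir i) (greenFlux lam f i) (x, y)
        + ∑ i, dirDeriv (tDir i) (fun w => flux i w * raiseIntegrand lam f w) (x, y)) := by
        congr with y
        exact raiseIntegrand_intertwining lam hf hc (x, y)
    _ = (c + lam ^ 2 / 2) * raise lam f x := by
        rw [integral_add ((hFint.const_mul _).fun_add hgreenInt) hfluxInt,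
          integral_add (hFint.const_mul _) hgreenInt, integral_const_mul, hgreen, hflux, add_zero,
          add_zero]
        rfl

end Raise

/-! ### Integrability of the wave integrand -/

section IteratedIntegral

variable {E Y Z F : Type*} [NormedAddCommGroup E] [NormedAddCommGroup Y] [NormedAddCommGroup Z]
  [NormedAddCommGroup F]

theorem RapidlyDecaying.norm_le_exp_mul_exp_neg_norm {G : E × (Y × Z) → F}
    (hG : RapidlyDecaying G) (B : ℝ) :
    ∃ C A : ℝ, ∀ x y z,
      ‖G (x, (y, z))‖ ≤ C * Real.exp (A * ‖x‖ - B * ‖y‖) * Real.exp (-‖z‖) := by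
  obtain ⟨C, A, hC, -, h⟩ := hG.exists_nonneg (|B| + 1)
  refine ⟨C, A, fun x y z => (h x (y, z)).trans ?_⟩
  rw [mul_assoc, ← Real.exp_add]
  gcongr
  have hz : ‖z‖ ≤ ‖(y, z)‖ := norm_snd_le (y, z)
  have hy : B * ‖y‖ ≤ |B| * ‖(y, z)‖ :=
    mul_le_mul (le_abs_self B) (norm_fst_le (y, z)) (norm_nonneg _) (abs_nonneg _)
  linarith

variable [NormedSpace ℝ Z] [FiniteDimensional ℝ Z] [MeasurableSpace Z] [BorelSpace Z]
  {μ : Measure Z} [μ.IsAddHaarMeasure]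

theorem RapidlyDecaying.integrable_snd {G : E × (Y × Z) → F} (hG : RapidlyDecaying G) {x : E}
    {y : Y} (hmeas : AEStronglyMeasurable (fun z => G (x, (y, z))) μ) :
    Integrable (fun z => G (x, (y, z))) μ := by
  obtain ⟨C, A, h⟩ := hG.norm_le_exp_mul_exp_neg_norm 0
  exact (integrable_exp_neg_norm.const_mul _).mono' hmeas (.of_forall (h x y))

theorem RapidlyDecaying.integral_snd [NormedSpace ℝ F] {G : E × (Y × Z) → F}
    (hG : RapidlyDecaying G) :
    RapidlyDecaying (fun p : E × Y => ∫ z, G (p.1, (p.2, z)) ∂μ) := by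
  intro B
  obtain ⟨C, A, h⟩ := hG.norm_le_exp_mul_exp_neg_norm B
  refine ⟨C * ∫ z, Real.exp (-‖z‖) ∂μ, A, fun x y => ?_⟩
  calc ‖∫ z, G (x, (y, z)) ∂μ‖
      ≤ ∫ z, C * Real.exp (A * ‖x‖ - B * ‖y‖) * Real.exp (-‖z‖) ∂μ :=
        norm_integral_le_of_norm_le (integrable_exp_neg_norm.const_mul _) (.of_forall (h x y))
    _ = C * (∫ z, Real.exp (-‖z‖) ∂μ) * Real.exp (A * ‖x‖ - B * ‖y‖) := by
        rw [integral_const_mul]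
        ring

end IteratedIntegral

section ProductIntegrability

variable {𝕜 E Y T : Type*} [RCLike 𝕜] [NormedAddCommGroup E] [NormedSpace ℝ E]
  [NormedAddCommGroup Y] [NormedSpace ℝ Y] [MeasurableSpace T] {ν : Measure T}

theorem RapidlyDecaying.integral_norm_mul_norm {f : T × Y → 𝕜} {ρ : E × Y → 𝕜}
    (hρ : RapidlyDecaying ρ) (hbound : ExpBounded fun y => ∫ s, ‖f (s, y)‖ ∂ν) :
    RapidlyDecaying fun w : E × Y => (∫ s, ‖f (s, w.2)‖ ∂ν) * ‖ρ w‖ :=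
  (hbound.comp_clm (.snd ℝ E Y)).mul_rapidlyDecaying (hρ.mono fun w => (norm_norm (ρ w)).le)

variable [FiniteDimensional ℝ Y] [MeasurableSpace Y] [BorelSpace Y] {μ : Measure Y}
  [μ.IsAddHaarMeasure] [SFinite ν]

theorem RapidlyDecaying.integrable_prod_mul {f : T × Y → 𝕜} {ρ : E × Y → 𝕜}
    (hρ : RapidlyDecaying ρ) (hf : Measurable f)
    (hint : ∀ y, Integrable (fun s => f (s, y)) ν)
    (hbound : ExpBounded fun y => ∫ s, ‖f (s, y)‖ ∂ν) {x : E}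
    (hρx : Measurable fun y => ρ (x, y)) :
    Integrable (fun p : T × Y => f p * ρ (x, p.2)) (ν.prod μ) := by
  have hmeas : Measurable fun p : T × Y => f p * ρ (x, p.2) := hf.mul (hρx.comp measurable_snd)
  refine (integrable_prod_iff' hmeas.aestronglyMeasurable).2
    ⟨.of_forall fun y => (hint y).mul_const (ρ (x, y)), ?_⟩
  simp only [norm_mul, integral_mul_const]
  exact (hρ.integral_norm_mul_norm hbound).integrable (x := x)
    (hf.norm.stronglyMeasurable.integral_prod_left'.aestronglyMeasurable.mul
      hρx.norm.aestronglyMeasurable)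

theorem RapidlyDecaying.expBounded_integral_prod_mul {f : T × Y → 𝕜} {ρ : E × Y → 𝕜}
    (hρ : RapidlyDecaying ρ) (hf : Measurable f)
    (hint : ∀ y, Integrable (fun s => f (s, y)) ν)
    (hbound : ExpBounded fun y => ∫ s, ‖f (s, y)‖ ∂ν) (hρm : ∀ x, Measurable fun y => ρ (x, y)) :
    ExpBounded fun x => ∫ p : T × Y, ‖f p * ρ (x, p.2)‖ ∂ν.prod μ := by
  have hfubini : ∀ x, ∫ p : T × Y, ‖f p * ρ (x, p.2)‖ ∂ν.prod μ =
      ∫ y, (∫ s, ‖f (s, y)‖ ∂ν) * ‖ρ (x, y)‖ ∂μ := fun x => by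
    rw [integral_prod_symm _ (hρ.integrable_prod_mul hf hint hbound (hρm x)).norm]
    simp only [norm_mul, integral_mul_const]
  simp only [hfubini]
  exact (hρ.integral_norm_mul_norm hbound).expBounded_integral

end ProductIntegrability

section Triangles

variable {m : ℕ}

@[simp] theorem complete_castSucc (X : Triangle m) (x : Fin (m + 1) → ℝ) (k : Fin m) :
    complete X x k.castSucc = X k :=
  Fin.snoc_castSucc (α := fun k : Fin (m + 1) => Fin ((k : ℕ) + 1) → ℝ) x X k

@[simp] theorem complete_last (X : Triangle m) (x : Fin (m + 1) → ℝ) :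
    complete X x (Fin.last m) = x :=
  Fin.snoc_last (α := fun k : Fin (m + 1) => Fin ((k : ℕ) + 1) → ℝ) x X

variable (m) in
theorem measurable_complete :
    Measurable fun p : Triangle m × (Fin (m + 1) → ℝ) => complete p.1 p.2 := by
  refine measurable_pi_iff.2 fun k => ?_
  induction k using Fin.lastCases with
  | last => simpa using measurable_snd
  | cast k =>
    simp only [complete_castSucc]
    exact (measurable_pi_apply k).comp measurable_fst

theorem complete_preimage_pi (s : (k : Fin (m + 1)) → Set (Fin ((k : ℕ) + 1) → ℝ)) :
    (fun p : Triangle m × (Fin (m + 1) → ℝ) => complete p.1 p.2) ⁻¹' Set.univ.pi s =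
      (Set.univ.pi fun k : Fin m => s k.castSucc) ×ˢ s (Fin.last m) := by
  ext p
  simp [Set.mem_pi, Fin.forall_fin_succ']

variable (m) in
theorem measurePreserving_complete :
    MeasurePreserving (fun p : Triangle m × (Fin (m + 1) → ℝ) => complete p.1 p.2)
      (volume.prod volume) volume := by
  refine ⟨measurable_complete m, (Measure.pi_eq fun s hs => ?_).symm⟩
  rw [Measure.map_apply (measurable_complete m) (.univ_pi hs), complete_preimage_pi,
    Measure.prod_prod, Fin.prod_univ_castSucc]
  exact congrArg (· * _) (Measure.pi_pi _ _)

theorem integral_triangle_succ {F : Type*} [NormedAddCommGroup F] [NormedSpace ℝ F]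
    {f : Triangle (m + 1) → F} (hf : AEStronglyMeasurable f volume) :
    ∫ X, f X =
      ∫ p : Triangle m × (Fin (m + 1) → ℝ), f (complete p.1 p.2) ∂volume.prod volume := by
  rw [← (measurePreserving_complete m).map_eq] at hf ⊢
  exact integral_map (measurable_complete m).aemeasurable hf

theorem volume_triangle_zero :
    (volume : Measure (Triangle 0)) = Measure.dirac fun k => k.elim0 :=
  Measure.pi_of_empty _ _

end Triangles

section RecursiveKernel

variable {r : ℕ} (lam : ℂ)

theorem recKernel_eq_integral_todaKernel (x : Fin (r + 2) → ℝ) (u : Fin (r + 1) → ℝ) :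
    recKernel r lam x u = ∫ t, todaKernel lam (x, (u, t)) := by
  simp only [recKernel, recIntegrand_eq_todaKernel]

variable (r) in
theorem continuous_todaKernel : Continuous (todaKernel (r := r) lam) :=
  (rapid_todaKernel 0 lam).continuous

theorem integrable_recIntegrand (x : Fin (r + 2) → ℝ) (u : Fin (r + 1) → ℝ) :
    Integrable (recIntegrand r lam x u) := by
  have hcont := continuous_todaKernel r lam
  simp only [funext (recIntegrand_eq_todaKernel lam x u)]
  exact (rapid_todaKernel 0 lam).bound.integrable_snd
    (Continuous.aestronglyMeasurable (by fun_prop))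

variable (r) in
theorem rapidlyDecaying_recKernel :
    RapidlyDecaying fun p : (Fin (r + 2) → ℝ) × (Fin (r + 1) → ℝ) => recKernel r lam p.1 p.2 := by
  simp only [recKernel_eq_integral_todaKernel]
  exact (rapid_todaKernel 0 lam).bound.integral_snd

variable (r) in
theorem measurable_recKernel :
    Measurable fun p : (Fin (r + 2) → ℝ) × (Fin (r + 1) → ℝ) => recKernel r lam p.1 p.2 := by
  have hcont := continuous_todaKernel r lam
  simp only [recKernel_eq_integral_todaKernel]
  refine (StronglyMeasurable.integral_prod_right
    (f := fun (p : (Fin (r + 2) → ℝ) × (Fin (r + 1) → ℝ)) t => todaKernel lam (p.1, (p.2, t)))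
    (Continuous.stronglyMeasurable ?_)).measurable
  simp only [Function.uncurry_def]
  fun_prop

end RecursiveKernel

section WaveIntegrand

theorem waveIntegrand_zero (lam : Fin 1 → ℂ) (x : Fin 1 → ℝ) (X : Triangle 0) :
    waveIntegrand 0 lam x X = Complex.exp (Complex.I * lam 0 * x 0) := by
  have hbottom : complete X x 0 = x := complete_last X x
  simp [waveIntegrand, hbottom]

variable {m : ℕ}

theorem waveIntegrand_complete (lam : Fin (m + 2) → ℂ) (x : Fin (m + 2) → ℝ) (X : Triangle m)
    (u : Fin (m + 1) → ℝ) :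
    waveIntegrand (m + 1) lam x (complete X u) =
      waveIntegrand m (fun i => lam i.castSucc) u X
        * recKernel m (lam (Fin.last (m + 1))) x u := by
  have hupper : ∀ k : Fin m, complete (complete X u) x k.castSucc.succ = complete X u k.succ :=
    fun k => complete_castSucc (complete X u) x k.succ
  have hbottom : complete (complete X u) x (Fin.last m).succ = x :=
    complete_last (complete X u) x
  have hnext : complete (complete X u) x (Fin.last m).castSucc = u := by
    rw [complete_castSucc, complete_last]
  rw [waveIntegrand, waveIntegrand, Fin.prod_univ_castSucc, ← mul_assoc]
  congr 1
  · congr 1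
    refine Finset.prod_congr rfl fun k _ => ?_
    rw [hupper, complete_castSucc]
    rfl
  · rw [hbottom, hnext]
    rfl

theorem measurable_waveIntegrand (lam : Fin (m + 1) → ℂ) :
    Measurable fun p : Triangle m × (Fin (m + 1) → ℝ) => waveIntegrand m lam p.2 p.1 := by
  have hrow : ∀ k : Fin (m + 1), Measurable fun p : Triangle m × (Fin (m + 1) → ℝ) =>
      complete p.1 p.2 k := measurable_pi_iff.1 (measurable_complete m)
  have htop : Measurable fun p : Triangle m × (Fin (m + 1) → ℝ) => complete p.1 p.2 0 0 :=
    measurable_pi_iff.1 (hrow 0) 0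
  unfold waveIntegrand
  refine Measurable.mul (by fun_prop) (Finset.measurable_fun_prod _ fun k _ => ?_)
  have hsucc : Measurable fun p : Triangle m × (Fin (m + 1) → ℝ) =>
      (complete p.1 p.2 k.succ : Fin ((k : ℕ) + 2) → ℝ) := hrow k.succ
  have hcastSucc : Measurable fun p : Triangle m × (Fin (m + 1) → ℝ) =>
      (complete p.1 p.2 k.castSucc : Fin ((k : ℕ) + 1) → ℝ) := hrow k.castSucc
  have hcomp := (measurable_recKernel k (lam k.succ)).comp (hsucc.prodMk hcastSucc)
  exact hcomp

theorem measurable_waveIntegrand_right (lam : Fin (m + 1) → ℂ) (x : Fin (m + 1) → ℝ) :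
    Measurable (waveIntegrand m lam x) := by
  have hpair : Measurable fun X : Triangle m => (X, x) := measurable_id.prodMk measurable_const
  have hcomp := (measurable_waveIntegrand lam).comp hpair
  exact hcomp

end WaveIntegrand

/-! ### The wave function -/

section Wave

variable {m : ℕ}

theorem integrable_waveIntegrand_and_expBounded (lam : Fin (m + 1) → ℂ) :
    (∀ x, Integrable (waveIntegrand m lam x)) ∧
      ExpBounded fun x => ∫ X, ‖waveIntegrand m lam x X‖ := by
  induction m with
  | zero =>
    refine ⟨fun x => ?_, ?_⟩
    · rw [volume_triangle_zero]
      exact integrable_dirac (by simp)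
    · simpa [volume_triangle_zero, waveIntegrand_zero, ExpBounded] using
        (Tame.cexp_const_mul_clm 0 (Complex.I * lam 0)
          (ContinuousLinearMap.proj (R := ℝ) (φ := fun _ : Fin 1 => ℝ) 0)).bound
  | succ m ih =>
    obtain ⟨hint, hbound⟩ := ih fun i => lam i.castSucc
    have hmeas := measurable_waveIntegrand fun i => lam i.castSucc
    have hkernel := rapidlyDecaying_recKernel m (lam (Fin.last (m + 1)))
    have hkernelMeas := fun x : Fin (m + 2) → ℝ =>
      (measurable_recKernel m (lam (Fin.last (m + 1)))).comp (measurable_prodMk_left (x := x))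
    refine ⟨fun x => ?_, ?_⟩
    · rw [← (measurePreserving_complete m).integrable_comp
        (measurable_waveIntegrand_right lam x).aestronglyMeasurable]
      simp only [Function.comp_def, waveIntegrand_complete]
      exact hkernel.integrable_prod_mul hmeas hint hbound (hkernelMeas x)
    · simp only [integral_triangle_succ
        (measurable_waveIntegrand_right lam _).norm.aestronglyMeasurable, waveIntegrand_complete]
      exact hkernel.expBounded_integral_prod_mul hmeas hint hbound hkernelMeas

theorem integrable_waveIntegrand (lam : Fin (m + 1) → ℂ) (x : Fin (m + 1) → ℝ) :
    Integrable (waveIntegrand m lam x) :=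
  (integrable_waveIntegrand_and_expBounded lam).1 x

theorem wave_zero (lam : Fin 1 → ℂ) :
    wave 0 lam = fun x => Complex.exp (Complex.I * lam 0 * x 0) := by
  funext x
  simp [wave, waveIntegrand_zero, volume_triangle_zero]

theorem wave_succ {n : ℕ} (lam : Fin (m + 2) → ℂ)
    (hwave : Tame n (wave m fun i => lam i.castSucc)) :
    wave (m + 1) lam = raise (lam (Fin.last (m + 1))) (wave m fun i => lam i.castSucc) := by
  funext x
  have hprod := (measurePreserving_complete m).integrable_comp_of_integrable
    (integrable_waveIntegrand lam x)
  simp only [Function.comp_def, waveIntegrand_complete] at hprod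
  have hraise : Integrable fun y => raiseIntegrand (lam (Fin.last (m + 1)))
      (wave m fun i => lam i.castSucc) (x, y) :=
    (rapid_raiseIntegrand _ hwave).integrable x
  rw [wave, integral_triangle_succ (measurable_waveIntegrand_right lam x).aestronglyMeasurable]
  simp only [waveIntegrand_complete]
  rw [integral_prod_symm _ hprod]
  refine (integral_congr_ae (.of_forall fun u => ?_)).trans (integral_prod _ hraise).symm
  simp only [raiseIntegrand, integral_mul_const, integral_const_mul,
    recKernel_eq_integral_todaKernel]
  rfl

theorem tame_wave (n : ℕ) (lam : Fin (m + 1) → ℂ) : Tame n (wave m lam) := by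
  induction m with
  | zero =>
    rw [wave_zero]
    exact Tame.cexp_const_mul_clm n (Complex.I * lam 0)
      (ContinuousLinearMap.proj (R := ℝ) (φ := fun _ : Fin 1 => ℝ) 0)
  | succ m ih =>
    rw [wave_succ lam (ih _)]
    exact tame_raise _ (ih _)

theorem hamiltonian_wave_zero (lam : Fin 1 → ℂ) (x : Fin 1 → ℝ) :
    hamiltonian 0 (wave 0 lam) x = (1 / 2) * lam 0 ^ 2 * wave 0 lam x := by
  have hderiv := dirDeriv_cexp_const_mul_clm (Complex.I * lam 0)
    (ContinuousLinearMap.proj (R := ℝ) (φ := fun _ : Fin 1 => ℝ) 0) (Pi.single 0 1)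
  have hdiff := differentiable_cexp_const_mul_clm (Complex.I * lam 0)
    (ContinuousLinearMap.proj (R := ℝ) (φ := fun _ : Fin 1 => ℝ) 0)
  rw [hamiltonian_eq_dirDeriv 0 (tame_wave 2 lam), wave_zero]
  simp only [ContinuousLinearMap.proj_apply] at hderiv hdiff
  simp only [Fin.sum_univ_succ, hderiv, dirDeriv_const_mul hdiff, potential, boundaryPotential,
    Pi.single_eq_same, Fin.sum_univ_zero, Complex.ofReal_one, Complex.ofReal_zero, mul_one,
    add_zero, zero_mul]
  linear_combination (-(1 / 2) * lam 0 ^ 2 * Complex.exp (Complex.I * lam 0 * x 0)) * Complex.I_sq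

theorem hamiltonian_wave (lam : Fin (m + 1) → ℂ) (x : Fin (m + 1) → ℝ) :
    hamiltonian m (wave m lam) x = (1 / 2) * (∑ i, lam i ^ 2) * wave m lam x := by
  induction m with
  | zero => simpa using hamiltonian_wave_zero lam x
  | succ m ih =>
    rw [wave_succ lam (tame_wave 2 _), hamiltonian_raise _ (tame_wave 2 _) (ih _),
      Fin.sum_univ_castSucc fun i => lam i ^ 2]
    ring

end Wave

/-! ### Gamma integrals along bent contours -/

section GammaContour

open Set Filter Topology

variable {S : ℝ} {a ω : ℂ}

/-- The integrand of the Gamma integral `∫ v^{a-1} e^{-S v} dv` in the variable `w = -log v`. -/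
def gammaIntegrand (S : ℝ) (a w : ℂ) : ℂ :=
  Complex.exp (-(a * w)) * Complex.exp (-(S * Complex.exp (-w)))

theorem gammaIntegrand_zero (S : ℝ) (a : ℂ) : gammaIntegrand S a 0 = Complex.exp (-S) := by
  simp [gammaIntegrand]

theorem continuous_gammaIntegrand (S : ℝ) (a : ℂ) : Continuous (gammaIntegrand S a) := by
  unfold gammaIntegrand
  fun_prop

theorem gammaIntegrand_add_one (S : ℝ) (a w : ℂ) :
    gammaIntegrand S (a + 1) w = Complex.exp (-w) * gammaIntegrand S a w := by
  rw [gammaIntegrand, gammaIntegrand, ← mul_assoc, ← Complex.exp_add (-w)]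
  ring_nf

theorem hasDerivAt_gammaIntegrand (S : ℝ) (a w : ℂ) :
    HasDerivAt (gammaIntegrand S a)
      (S * gammaIntegrand S (a + 1) w - a * gammaIntegrand S a w) w := by
  have hexp : HasDerivAt (fun w => Complex.exp (-(a * w))) _ w :=
    ((hasDerivAt_id w).const_mul a).neg.cexp
  have hexpExp : HasDerivAt (fun w => Complex.exp (-(S * Complex.exp (-w)))) _ w :=
    ((hasDerivAt_neg w).cexp.const_mul (S : ℂ)).neg.cexp
  refine (hexp.mul hexpExp).congr_deriv ?_
  rw [gammaIntegrand_add_one, gammaIntegrand]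
  simp only [id_eq, Pi.neg_apply]
  ring

theorem hasDerivAt_gammaIntegrand_ray (S : ℝ) (a ω : ℂ) (s : ℝ) :
    HasDerivAt (fun s : ℝ => gammaIntegrand S a (s * ω))
      (S * (gammaIntegrand S (a + 1) (s * ω) * ω) - a * (gammaIntegrand S a (s * ω) * ω)) s := by
  have hmul : HasDerivAt (fun z : ℂ => z * ω) ω s := hasDerivAt_mul_const ω
  refine ((hasDerivAt_gammaIntegrand S a (s * ω)).comp (s : ℂ) hmul).comp_ofReal.congr_deriv ?_
  ring

theorem exists_norm_gammaIntegrand_le_exp (hS : 0 < S) (a : ℂ) :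
    ∃ C : ℝ, ∀ s : ℝ, s ≤ 0 → ‖gammaIntegrand S a s‖ ≤ C * Real.exp s := by
  obtain ⟨n, hn⟩ := exists_nat_ge (a.re + 1)
  refine ⟨n.factorial / S ^ n, fun s hs => ?_⟩
  have hnorm : ‖gammaIntegrand S a s‖
      = Real.exp (-(a.re * s)) * Real.exp (-(S * Real.exp (-s))) := by
    rw [gammaIntegrand, norm_mul, Complex.norm_exp, Complex.norm_exp]
    norm_cast
    simp
  have hdecay : Real.exp (-(S * Real.exp (-s))) ≤ n.factorial / S ^ n * Real.exp (n * s) := by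
    rw [Real.exp_neg, inv_le_comm₀ (Real.exp_pos _) (by positivity)]
    refine le_of_eq_of_le ?_
      (Real.pow_div_factorial_le_exp (S * Real.exp (-s)) (by positivity) n)
    rw [mul_pow, ← Real.exp_nat_mul, mul_neg, Real.exp_neg]
    field_simp
  calc ‖gammaIntegrand S a s‖
      ≤ Real.exp (-(a.re * s)) * (n.factorial / S ^ n * Real.exp (n * s)) := by
        rw [hnorm]
        gcongr
    _ = n.factorial / S ^ n * Real.exp (-(a.re * s) + n * s) := by rw [Real.exp_add]; ring
    _ ≤ n.factorial / S ^ n * Real.exp s := by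
        gcongr
        nlinarith

theorem integrableOn_gammaIntegrand_Iic (hS : 0 < S) (a : ℂ) :
    IntegrableOn (fun s : ℝ => gammaIntegrand S a s) (Iic 0) := by
  obtain ⟨C, hC⟩ := exists_norm_gammaIntegrand_le_exp hS a
  exact Integrable.mono' ((integrableOn_exp_Iic 0).const_mul C)
    ((continuous_gammaIntegrand S a).comp Complex.continuous_ofReal).aestronglyMeasurable
    ((ae_restrict_mem measurableSet_Iic).mono hC)

theorem norm_gammaIntegrand_ray_le (S : ℝ) (a : ℂ) (hω : 0 ≤ ω.re) {s : ℝ} (hs : 0 ≤ s) :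
    ‖gammaIntegrand S a (s * ω)‖ ≤ Real.exp |S| * Real.exp (-(a * ω).re * s) := by
  have hle : ‖Complex.exp (-(s * ω))‖ ≤ 1 := by
    rw [Complex.norm_exp, Real.exp_le_one_iff, Complex.neg_re, Complex.re_ofReal_mul]
    linarith [mul_nonneg hs hω]
  rw [gammaIntegrand, norm_mul, mul_comm]
  refine mul_le_mul ?_ (le_of_eq ?_) (norm_nonneg _) (Real.exp_pos _).le
  · refine (Complex.norm_exp_le_exp_norm _).trans (Real.exp_le_exp.2 ?_)
    rw [norm_neg, norm_mul, Complex.norm_real, Real.norm_eq_abs]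
    exact mul_le_of_le_one_right (abs_nonneg S) hle
  · rw [Complex.norm_exp, mul_left_comm, Complex.neg_re, Complex.re_ofReal_mul]
    ring_nf

theorem integrableOn_gammaIntegrand_ray (S : ℝ) (hω : 0 ≤ ω.re) (ha : 0 < (a * ω).re) :
    IntegrableOn (fun s : ℝ => gammaIntegrand S a (s * ω) * ω) (Ioi 0) := by
  have hcont := continuous_gammaIntegrand S a
  refine Integrable.mul_const (Integrable.mono'
    ((integrableOn_exp_mul_Ioi (neg_neg_of_pos ha) 0).const_mul (Real.exp |S|))
    (by fun_prop : Continuous fun s : ℝ => gammaIntegrand S a (s * ω)).aestronglyMeasurable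
    ((ae_restrict_mem measurableSet_Ioi).mono fun s hs => ?_)) ω
  exact norm_gammaIntegrand_ray_le S a hω (mem_Ioi.1 hs).le

theorem mul_integral_gammaIntegrand_Iic (hS : 0 < S) (a : ℂ) :
    a * ∫ s : ℝ in Iic 0, gammaIntegrand S a s
      = S * (∫ s : ℝ in Iic 0, gammaIntegrand S (a + 1) s) - Complex.exp (-S) := by
  have hint := (integrableOn_gammaIntegrand_Iic hS a).const_mul a
  have hint' := (integrableOn_gammaIntegrand_Iic hS (a + 1)).const_mul (S : ℂ)
  have htendsto : Tendsto (fun s : ℝ => gammaIntegrand S a s) atBot (𝓝 0) := by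
    obtain ⟨C, hC⟩ := exists_norm_gammaIntegrand_le_exp hS a
    exact squeeze_zero_norm' ((eventually_le_atBot 0).mono hC)
      (by simpa using Real.tendsto_exp_atBot.const_mul C)
  have h := integral_Iic_of_hasDerivAt_of_tendsto' (a := (0 : ℝ))
    (fun s _ => (hasDerivAt_gammaIntegrand S a s).comp_ofReal) (hint'.sub hint) htendsto
  rw [integral_sub hint' hint, integral_const_mul, integral_const_mul, Complex.ofReal_zero,
    gammaIntegrand_zero] at h
  linear_combination -h

theorem mul_integral_gammaIntegrand_ray (S : ℝ) (hω : 0 ≤ ω.re) (ha : 0 < (a * ω).re) :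
    a * ∫ s : ℝ in Ioi 0, gammaIntegrand S a (s * ω) * ω
      = S * (∫ s : ℝ in Ioi 0, gammaIntegrand S (a + 1) (s * ω) * ω) + Complex.exp (-S) := by
  have ha' : 0 < ((a + 1) * ω).re := by
    rw [add_mul, one_mul, Complex.add_re]
    linarith
  have hint := (integrableOn_gammaIntegrand_ray S hω ha).const_mul a
  have hint' := (integrableOn_gammaIntegrand_ray S hω ha').const_mul (S : ℂ)
  have htendsto : Tendsto (fun s : ℝ => gammaIntegrand S a (s * ω)) atTop (𝓝 0) := by
    refine squeeze_zero_norm' ((eventually_ge_atTop 0).mono fun s hs =>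
      norm_gammaIntegrand_ray_le S a hω hs) ?_
    simpa using (Real.tendsto_exp_atBot.comp
      (tendsto_id.const_mul_atTop_of_neg (neg_neg_of_pos ha))).const_mul (Real.exp |S|)
  have h := integral_Ioi_of_hasDerivAt_of_tendsto' (a := (0 : ℝ))
    (fun s _ => hasDerivAt_gammaIntegrand_ray S a ω s) (hint'.sub hint) htendsto
  rw [integral_sub hint' hint, integral_const_mul, integral_const_mul, Complex.ofReal_zero,
    zero_mul, gammaIntegrand_zero] at h
  linear_combination -h

theorem hasSum_gammaIntegrand (S : ℝ) (a w : ℂ) :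
    HasSum (fun n : ℕ => (-(S : ℂ)) ^ n / n.factorial * Complex.exp (-((a + n) * w)))
      (gammaIntegrand S a w) := by
  have hexp : HasSum (fun n : ℕ => (-(S * Complex.exp (-w))) ^ n / n.factorial)
      (Complex.exp (-(S * Complex.exp (-w)))) := by
    rw [Complex.exp_eq_exp_ℂ]
    exact NormedSpace.expSeries_div_hasSum_exp _
  refine (hexp.mul_left (Complex.exp (-(a * w)))).congr_fun fun n => ?_
  rw [add_mul, neg_add, Complex.exp_add, ← mul_neg (n : ℂ), Complex.exp_nat_mul,
    neg_mul_eq_neg_mul (S : ℂ), mul_pow]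
  ring

theorem integral_cexp_ray (ha : 0 < (a * ω).re) :
    ∫ s : ℝ in Ioi 0, Complex.exp (-(a * (s * ω))) * ω = a⁻¹ := by
  have ha0 : a ≠ 0 := fun h => by simp [h] at ha
  have hω0 : ω ≠ 0 := fun h => by simp [h] at ha
  have hneg : (-(a * ω)).re < 0 := by simpa only [Complex.neg_re, neg_lt_zero] using ha
  have hexp : ∀ s : ℝ, -(a * (s * ω)) = -(a * ω) * s := fun s => by ring
  simp only [hexp]
  rw [integral_mul_const, integral_exp_mul_complex_Ioi hneg, Complex.ofReal_zero, mul_zero,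
    Complex.exp_zero]
  field_simp

theorem re_mul_le_re_add_natCast_mul (a : ℂ) (hω : 0 ≤ ω.re) (n : ℕ) :
    (a * ω).re ≤ ((a + n) * ω).re := by
  rw [add_mul, Complex.add_re, ← Complex.ofReal_natCast, Complex.re_ofReal_mul]
  exact le_add_of_nonneg_right (by positivity)

/- The sum of the series does not involve `ω`, so the direction of the ray may be changed without
appealing to Cauchy's theorem. -/
theorem hasSum_integral_gammaIntegrand_ray (S : ℝ) (hω : 0 ≤ ω.re) (ha : 0 < (a * ω).re) :
    HasSum (fun n : ℕ => (-(S : ℂ)) ^ n / n.factorial * (a + n)⁻¹)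
      (∫ s : ℝ in Ioi 0, gammaIntegrand S a (s * ω) * ω) := by
  have hre : ∀ n : ℕ, 0 < ((a + n) * ω).re := fun n =>
    ha.trans_le (re_mul_le_re_add_natCast_mul a hω n)
  let F : ℕ → ℝ → ℂ := fun n s =>
    (-(S : ℂ)) ^ n / n.factorial * (Complex.exp (-((a + n) * (s * ω))) * ω)
  have hF : ∀ n s, F n s
      = (-(S : ℂ)) ^ n / n.factorial * ω * Complex.exp (-((a + n) * ω) * s) := fun n s => by
    simp only [F]
    ring_nf
  have hint : ∀ n, Integrable (F n) (volume.restrict (Ioi 0)) := fun n => by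
    simp only [funext (hF n)]
    exact (integrableOn_exp_mul_complex_Ioi (by simpa using hre n) 0).const_mul _
  have hnorm : ∀ n, ∫ s in Ioi 0, ‖F n s‖
      = |S| ^ n / n.factorial * (‖ω‖ * (1 / ((a + n) * ω).re)) := fun n => by
    simp only [hF, norm_mul, norm_div, norm_pow, norm_neg, Complex.norm_real,
      Real.norm_eq_abs, Complex.norm_natCast, Complex.norm_exp, Complex.re_mul_ofReal,
      Complex.neg_re]
    rw [integral_const_mul, integral_exp_mul_Ioi (neg_neg_of_pos (hre n)), mul_zero,
      Real.exp_zero, neg_div_neg_eq, mul_assoc]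
  have hsum : Summable fun n => ∫ s in Ioi 0, ‖F n s‖ := by
    simp only [hnorm]
    refine Summable.of_nonneg_of_le (fun n => ?_) (fun n => ?_)
      ((Real.summable_pow_div_factorial |S|).mul_right (‖ω‖ * (1 / (a * ω).re)))
    · have := hre n
      positivity
    · have := re_mul_le_re_add_natCast_mul a hω n
      gcongr
  have hpoint : ∀ s : ℝ, ∑' n, F n s = gammaIntegrand S a (s * ω) * ω := fun s =>
    (tsum_congr fun n => (mul_assoc _ _ ω).symm).trans
      ((hasSum_gammaIntegrand S a (s * ω)).mul_right ω).tsum_eq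
  simpa only [hpoint, F, integral_const_mul, integral_cexp_ray (hre _)] using
    hasSum_integral_of_summable_integral_norm hint hsum

theorem integral_gammaIntegrand_ofReal (hS : 0 < S) (ha : 0 < a.re) :
    ∫ s : ℝ, gammaIntegrand S a s = Complex.Gamma a * (S : ℂ) ^ (-a) := by
  have hpow : (1 / (S : ℂ)) ^ a = (S : ℂ) ^ (-a) := by
    rw [one_div, Complex.inv_cpow _ _ (by
      rw [Complex.arg_ofReal_of_nonneg hS.le]; exact Real.pi_pos.ne), Complex.cpow_neg]
  have hsubst := integral_image_eq_integral_abs_deriv_smul MeasurableSet.univ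
    (fun s _ => (Real.hasDerivAt_exp s).hasDerivWithinAt) Real.exp_injective.injOn
    (fun v : ℝ => (v : ℂ) ^ (a - 1) * Complex.exp (-(S * v)))
  rw [image_univ, Real.range_exp, Complex.integral_cpow_mul_exp_neg_mul_Ioi ha hS,
    setIntegral_univ, hpow] at hsubst
  rw [← integral_neg_eq_self, mul_comm, hsubst]
  refine integral_congr_ae (.of_forall fun s => ?_)
  have he : ((Real.exp s : ℝ) : ℂ) ≠ 0 := by exact_mod_cast (Real.exp_pos s).ne'
  beta_reduce
  rw [abs_of_pos (Real.exp_pos s), Complex.real_smul, ← mul_assoc, Complex.cpow_sub _ _ he,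
    Complex.cpow_one, mul_div_cancel₀ _ he, gammaIntegrand, Complex.cpow_def_of_ne_zero he,
    ← Complex.ofReal_log (Real.exp_pos s).le, Real.log_exp]
  push_cast
  ring_nf

/- The ray in direction `ω` may reach parameters `a` with `a.re ≤ 0`, where the real Gamma integral
diverges; there the recursion `a ↦ a + 1` takes over. -/
theorem integral_gammaIntegrand_Iic_add_ray (hS : 0 < S) (hω : 0 ≤ ω.re)
    (ha : 0 < (a * ω).re) :
    (∫ s : ℝ in Iic 0, gammaIntegrand S a s) + ∫ s : ℝ in Ioi 0, gammaIntegrand S a (s * ω) * ω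
      = Complex.Gamma a * (S : ℂ) ^ (-a) := by
  obtain ⟨n, hn⟩ := exists_nat_gt (-a.re)
  induction n generalizing a with
  | zero =>
    have hre : 0 < a.re := by simpa using hn
    have hre' : 0 < (a * 1).re := by rwa [mul_one]
    have hrotate := (hasSum_integral_gammaIntegrand_ray S hω ha).unique
      (hasSum_integral_gammaIntegrand_ray S zero_le_one hre')
    have hint := integrableOn_gammaIntegrand_ray S (ω := 1) zero_le_one hre'
    simp only [mul_one] at hrotate hint
    rw [hrotate, ← integral_gammaIntegrand_ofReal hS hre]
    exact intervalIntegral.integral_Iic_add_Ioi (integrableOn_gammaIntegrand_Iic hS a) hint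
  | succ n ih =>
    have ha0 : a ≠ 0 := fun h => by simp [h] at ha
    have hS0 : (S : ℂ) ≠ 0 := by exact_mod_cast hS.ne'
    have hstep : a * ((∫ s : ℝ in Iic 0, gammaIntegrand S a s)
          + ∫ s : ℝ in Ioi 0, gammaIntegrand S a (s * ω) * ω)
        = S * (Complex.Gamma (a + 1) * (S : ℂ) ^ (-(a + 1))) := by
      rw [← ih (by rw [add_mul, one_mul, Complex.add_re]; linarith)
        (by rw [Complex.add_re, Complex.one_re]; push_cast at hn; linarith)]
      linear_combination mul_integral_gammaIntegrand_Iic hS a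
        + mul_integral_gammaIntegrand_ray S hω ha
    rw [Complex.Gamma_add_one a ha0, neg_add, Complex.cpow_add _ _ hS0,
      Complex.cpow_neg_one] at hstep
    refine mul_left_cancel₀ ha0 (hstep.trans ?_)
    field_simp

variable {θ : ℝ}

theorem gammaIntegrand_yContour_eq_piecewise (S : ℝ) (a : ℂ) (θ : ℝ) :
    (fun s => gammaIntegrand S a (yContour θ s - Real.pi * Complex.I) * yVelocity θ s)
      = (Iic 0).piecewise (fun s : ℝ => gammaIntegrand S a s) (fun s : ℝ =>
        gammaIntegrand S a (s * Complex.exp (θ * Complex.I)) * Complex.exp (θ * Complex.I)) := by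
  funext s
  by_cases hs : s ≤ 0 <;> simp [yContour, yVelocity, piecewise, hs]

theorem re_exp_mul_I_nonneg (hθ : |θ| ≤ Real.pi / 2) :
    0 ≤ (Complex.exp (θ * Complex.I)).re := by
  rw [Complex.exp_ofReal_mul_I_re]
  exact Real.cos_nonneg_of_mem_Icc (abs_le.1 hθ)

theorem integrable_gammaIntegrand_yContour (hS : 0 < S) (hθ : |θ| ≤ Real.pi / 2)
    (ha : 0 < (a * Complex.exp (θ * Complex.I)).re) :
    Integrable fun s =>
      gammaIntegrand S a (yContour θ s - Real.pi * Complex.I) * yVelocity θ s := by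
  rw [gammaIntegrand_yContour_eq_piecewise]
  refine Integrable.piecewise measurableSet_Iic (integrableOn_gammaIntegrand_Iic hS a) ?_
  rw [compl_Iic]
  exact integrableOn_gammaIntegrand_ray S (re_exp_mul_I_nonneg hθ) ha

theorem integral_gammaIntegrand_yContour (hS : 0 < S) (hθ : |θ| ≤ Real.pi / 2)
    (ha : 0 < (a * Complex.exp (θ * Complex.I)).re) :
    ∫ s, gammaIntegrand S a (yContour θ s - Real.pi * Complex.I) * yVelocity θ s
      = Complex.Gamma a * (S : ℂ) ^ (-a) := by
  have hω := re_exp_mul_I_nonneg hθ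
  rw [gammaIntegrand_yContour_eq_piecewise, integral_piecewise measurableSet_Iic
    (integrableOn_gammaIntegrand_Iic hS a)
    (compl_Iic (a := (0 : ℝ)) ▸ integrableOn_gammaIntegrand_ray S hω ha), compl_Iic]
  exact integral_gammaIntegrand_Iic_add_ray hS hω ha

end GammaContour

/-! ### The second form of the recursive kernel -/

section SecondForm

variable {r : ℕ} (lam : ℂ) (θ : ℝ) (x : Fin (r + 2) → ℝ) (x' : Fin (r + 1) → ℝ)

/-- The quantity `e^{-x_{k+1}} + e^{-x'_k}` of the recursive kernel, `k = r + 1`. -/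
def endSum (x : Fin (r + 2) → ℝ) (x' : Fin (r + 1) → ℝ) : ℝ :=
  Real.exp (-x (Fin.last (r + 1))) + Real.exp (-x' (Fin.last r))

theorem endSum_pos : 0 < endSum x x' := by
  unfold endSum
  positivity

theorem kernelDCy_eq_kernelDC_mul (z : Fin (r + 1) → ℂ) (y : ℂ) :
    kernelDCy r x z y
      = kernelDC r x z * Complex.exp (Complex.exp (-x (Fin.last (r + 1)) - y)) :=
  Complex.exp_add _ _

theorem kernelCDy_eq_kernelCD_mul (z : Fin (r + 1) → ℂ) (y : ℂ) :
    kernelCDy r z x' y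
      = kernelCD r z x' * Complex.exp (Complex.exp (-x' (Fin.last r) - y)) :=
  Complex.exp_add _ _

theorem cexp_cexp_sub_mul_cexp_cexp_sub (y : ℂ) :
    Complex.exp (Complex.exp (-x (Fin.last (r + 1)) - y))
        * Complex.exp (Complex.exp (-x' (Fin.last r) - y))
      = Complex.exp (-(endSum x x' * Complex.exp (-(y - Real.pi * Complex.I)))) := by
  rw [← Complex.exp_add, neg_sub, endSum]
  simp only [Complex.exp_sub, Complex.exp_pi_mul_I]
  push_cast
  ring_nf

theorem altIntegrand_eq_recIntegrand_mul_gammaIntegrand (p : (Fin (r + 1) → ℝ) × ℝ) :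
    altIntegrand r lam θ x x' p
      = Complex.exp (-(2 * Real.pi * lam)) * (endSum x x' : ℂ) ^ (-(2 * Complex.I * lam))
          * recIntegrand r lam x x' p.1
        * (gammaIntegrand (endSum x x') (-(2 * Complex.I * lam))
            (yContour θ p.2 - Real.pi * Complex.I) * yVelocity θ p.2) := by
  have hphase : ∀ A y : ℂ, Complex.exp (Complex.I * lam * (A + 2 * y))
      = Complex.exp (-(2 * Real.pi * lam)) * Complex.exp (Complex.I * lam * A)
        * Complex.exp (-(-(2 * Complex.I * lam) * (y - Real.pi * Complex.I))) := fun A y => by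
    rw [← Complex.exp_add, ← Complex.exp_add]
    congr 1
    linear_combination (2 * lam * Real.pi) * Complex.I_sq
  have hpow : (endSum x x' : ℂ) ^ (-(2 * Complex.I * lam))
      * (endSum x x' : ℂ) ^ (2 * Complex.I * lam) = 1 := by
    rw [← Complex.cpow_add _ _ (Complex.ofReal_ne_zero.2 (endSum_pos x x').ne'),
      neg_add_cancel, Complex.cpow_zero]
  refine (one_mul _).symm.trans ?_
  rw [← hpow, altIntegrand, recIntegrand, hphase, kernelDCy_eq_kernelDC_mul,
    kernelCDy_eq_kernelCD_mul, gammaIntegrand, ← cexp_cexp_sub_mul_cexp_cexp_sub, ← endSum]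
  ring

variable {lam θ}

theorem re_neg_two_mul_I_mul_pos (hlam : 0 < (lam * Complex.exp (θ * Complex.I)).im) :
    0 < (-(2 * Complex.I * lam) * Complex.exp (θ * Complex.I)).re := by
  have hre : (-(2 * Complex.I * lam) * Complex.exp (θ * Complex.I)).re
      = 2 * (lam * Complex.exp (θ * Complex.I)).im := by
    rw [show -(2 * Complex.I * lam) * Complex.exp (θ * Complex.I)
      = ((-2 : ℝ) : ℂ) * (Complex.I * (lam * Complex.exp (θ * Complex.I))) by push_cast; ring,
      Complex.re_ofReal_mul, Complex.I_mul_re]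
    ring
  linarith

theorem gamma_ne_zero_of_re_mul_pos {a ω : ℂ} (hω : 0 ≤ ω.re) (ha : 0 < (a * ω).re) :
    Complex.Gamma a ≠ 0 := by
  refine Complex.Gamma_ne_zero fun n hn => ?_
  have hre := re_mul_le_re_add_natCast_mul a hω n
  rw [hn, neg_add_cancel, zero_mul, Complex.zero_re, ← hn] at hre
  exact ha.not_ge hre

theorem integrable_altIntegrand (hθ : |θ| ≤ Real.pi / 2)
    (hlam : 0 < (lam * Complex.exp (θ * Complex.I)).im) :
    Integrable (altIntegrand r lam θ x x') := by
  rw [funext (altIntegrand_eq_recIntegrand_mul_gammaIntegrand lam θ x x')]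
  exact ((integrable_recIntegrand lam x x').const_mul _).mul_prod
    (integrable_gammaIntegrand_yContour (endSum_pos x x') hθ (re_neg_two_mul_I_mul_pos hlam))

theorem integral_altIntegrand (hθ : |θ| ≤ Real.pi / 2)
    (hlam : 0 < (lam * Complex.exp (θ * Complex.I)).im) :
    ∫ p, altIntegrand r lam θ x x' p
      = Complex.exp (-(2 * Real.pi * lam)) * Complex.Gamma (-(2 * Complex.I * lam))
        * recKernel r lam x x' := by
  have hS : (endSum x x' : ℂ) ≠ 0 := Complex.ofReal_ne_zero.2 (endSum_pos x x').ne'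
  have hpow : (endSum x x' : ℂ) ^ (-(2 * Complex.I * lam))
      * (endSum x x' : ℂ) ^ (-(-(2 * Complex.I * lam))) = 1 := by
    rw [← Complex.cpow_add _ _ hS, add_neg_cancel, Complex.cpow_zero]
  simp only [altIntegrand_eq_recIntegrand_mul_gammaIntegrand]
  rw [Measure.volume_eq_prod, integral_prod_mul (fun t => _ * recIntegrand r lam x x' t)
    fun s => gammaIntegrand _ _ (yContour θ s - _) * yVelocity θ s, integral_const_mul,
    ← recKernel, integral_gammaIntegrand_yContour (endSum_pos x x') hθ
      (re_neg_two_mul_I_mul_pos hlam)]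
  linear_combination Complex.exp (-(2 * Real.pi * lam)) * recKernel r lam x x'
    * Complex.Gamma (-(2 * Complex.I * lam)) * hpow

theorem recKernel_eq_integral_altIntegrand (hθ : |θ| ≤ Real.pi / 2)
    (hlam : 0 < (lam * Complex.exp (θ * Complex.I)).im) :
    recKernel r lam x x'
      = Complex.exp (2 * Real.pi * lam) / Complex.Gamma (-(2 * Complex.I * lam))
        * ∫ p, altIntegrand r lam θ x x' p := by
  have hGamma := gamma_ne_zero_of_re_mul_pos (re_exp_mul_I_nonneg hθ)
    (re_neg_two_mul_I_mul_pos hlam)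
  rw [integral_altIntegrand x x' hθ hlam, Complex.exp_neg]
  generalize Complex.Gamma (-(2 * Complex.I * lam)) = G at hGamma ⊢
  field_simp

end SecondForm

end

end TodaD

theorem mainTheorem5 (m : ℕ) (lam : Fin (m + 1) → ℂ) :
    -- the integrals over `z` and over the triangular array converge absolutely
    (∀ (k : Fin m) (x : Fin ((k : ℕ) + 2) → ℝ) (x' : Fin ((k : ℕ) + 1) → ℝ),
      MeasureTheory.Integrable (TodaD.recIntegrand k (lam k.succ) x x')) ∧
    (∀ x : Fin (m + 1) → ℝ, MeasureTheory.Integrable (TodaD.waveIntegrand m lam x)) ∧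
    -- the eigenfunction equation
    ContDiff ℝ 2 (TodaD.wave m lam) ∧
    (∀ x : Fin (m + 1) → ℝ,
      TodaD.hamiltonian m (TodaD.wave m lam) x
        = (1 / 2 : ℂ) * (∑ i, lam i ^ 2) * TodaD.wave m lam x) ∧
    -- the second form of the recursive kernel
    (∀ (k : Fin m) (θ : ℝ), |θ| < Real.pi / 2 →
      0 < (lam k.succ * Complex.exp (θ * Complex.I)).im →
      ∀ (x : Fin ((k : ℕ) + 2) → ℝ) (x' : Fin ((k : ℕ) + 1) → ℝ),
        MeasureTheory.Integrable (TodaD.altIntegrand k (lam k.succ) θ x x') ∧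
        TodaD.recKernel k (lam k.succ) x x'
          = Complex.exp (2 * Real.pi * lam k.succ) / Complex.Gamma (-(2 * Complex.I * lam k.succ))
            * ∫ p, TodaD.altIntegrand k (lam k.succ) θ x x' p) := by
  exact ⟨fun k x x' => TodaD.integrable_recIntegrand (lam k.succ) x x',
    TodaD.integrable_waveIntegrand lam, (TodaD.tame_wave 2 lam).contDiff,
    TodaD.hamiltonian_wave lam, fun k _ hθ hlam x x' =>
      ⟨TodaD.integrable_altIntegrand x x' hθ.le hlam,
        TodaD.recKernel_eq_integral_altIntegrand x x' hθ.le hlam⟩⟩
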